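/- Let $n\ge 1$ be an integer, let $\mathbb{B}^n$ be the open Euclidean unit ball of $\mathbb{C}^n$, and let $\sigma$ be the normalized surface measure on $\partial\mathbb{B}^n$. For a function $F$ on $\mathbb{B}^n$ with values in a normed space, $p\in(0,\infty)$ and $r\in(0,1)$, put $$M_p(r,F)=\Big(\int_{\partial\mathbb{B}^n}\|F(r\zeta)\|^p\,d\sigma(\zeta)\Big)^{1/p}.$$ The generalized Hardy space $\mathcal{H}_g^p(\mathbb{B}^n)$ consists of the measurable functions $f:\mathbb{B}^n\to\mathbb{C}$ for which $M_p(r,f)$ exists for every $r\in(0,1)$ and $\sup_{0<r<1}M_p(r,f)<\infty$. With $z_k=x_k+iy_k$, $f_{z_k}=\frac12(f_{x_k}-if_{y_k})$ and $f_{\overline z_k}=\frac12(f_{x_k}+if_{y_k})$, put $$D_f=(f_{z_1},\dots,f_{z_n},f_{\overline z_1},\dots,f_{\overline z_n}),\qquad \|D_f\|=\Big(\sum_{k=1}^n\big(|f_{z_k}|^2+|f_{\overline z_k}|^2\big)\Big)^{1/2},$$ $$D^*_f=\Big(\sum_{j=1}^n\sum_{k=1}^n\big(|f_{z_kz_j}|^2+|f_{z_k\overline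 z_j}|^2+|f_{\overline z_kz_j}|^2+|f_{\overline z_k\overline z_j}|^2\big)\Big)^{1/2}.$$ Let $p\in[2,\infty)$, let $\tau,\eta\ge 0$ be constants with $\eta+\tau<4n/p$, and let $f:\mathbb{B}^n\to\mathbb{C}$ be twice continuously differentiable (in the real sense) with $$\Delta f(z)=\tau f(z)+\eta\,\mathrm{Re}\,f(z)\quad\text{for all } z\in\mathbb{B}^n,\qquad \Delta=\sum_{k=1}^n\Big(\frac{\partial^2}{\partial x_k^2}+\frac{\partial^2}{\partial y_k^2}\Big).$$ If $$M_p(r,D^*_f)=O\Big(\frac1{1-r}\Big)\quad\text{as } r\to1^-,$$ then $$M_p(r,D_f)=O\Big(\Big(\log\frac1{1-r}\Big)^{1/2}\Big)\quad\text{as } r\to1^-,$$ and $f\in\mathcal{H}_g^p(\mathbb{B}^n)$. -/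

import Mathlib

open MeasureTheory Filter Asymptotics
open scoped Topology

namespace YukawaHardy

noncomputable section

/-- `ℂⁿ` with its Euclidean norm. -/
abbrev Cn (n : ℕ) : Type := EuclideanSpace ℂ (Fin n)

/-- The open unit ball of `ℂⁿ`. -/
abbrev unitBall (n : ℕ) : Set (Cn n) := Metric.ball (0 : Cn n) 1

/-- The normalized Lebesgue surface measure on the unit sphere of `ℂⁿ`. -/
def sphereMeasure (n : ℕ) : Measure (Metric.sphere (0 : Cn n) 1) :=
  ((volume : Measure (Cn n)).toSphere Set.univ)⁻¹ • (volume : Measure (Cn n)).toSphere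

/-- The integral mean `M_p(r, F) = (∫ ‖F(rζ)‖ ^ p dσ(ζ)) ^ (1 / p)` over the unit sphere. -/
def integralMean {n : ℕ} {G : Type*} [NormedAddCommGroup G] (p r : ℝ) (F : Cn n → G) : ℝ :=
  (∫ ζ : Metric.sphere (0 : Cn n) 1, ‖F (r • (ζ : Cn n))‖ ^ p ∂(sphereMeasure n)) ^ (1 / p)

/-- Membership in the generalized Hardy space `H_g^p` of the unit ball, for `0 < p < ∞`: `f` is
measurable on the ball, its integral means `M_p(r, f)` all exist (as finite integrals), and they
are bounded for `0 < r < 1`. Only the values of `f` on the unit ball matter. -/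
structure MemHardy {n : ℕ} (p : ℝ) (f : Cn n → ℂ) : Prop where
  measurable : Measurable (fun z : unitBall n => f (z : Cn n))
  integrable : ∀ r ∈ Set.Ioo (0 : ℝ) 1,
    Integrable (fun ζ : Metric.sphere (0 : Cn n) 1 => ‖f (r • (ζ : Cn n))‖ ^ p) (sphereMeasure n)
  bddAbove : BddAbove ((fun r : ℝ => integralMean p r f) '' Set.Ioo (0 : ℝ) 1)

/-- `∂f/∂z_k = (∂f/∂x_k - i ∂f/∂y_k) / 2`. -/
def dz {n : ℕ} (k : Fin n) (f : Cn n → ℂ) (z : Cn n) : ℂ :=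
  (1 / 2) * (fderiv ℝ f z (EuclideanSpace.single k 1)
    - Complex.I * fderiv ℝ f z (EuclideanSpace.single k Complex.I))

/-- `∂f/∂z̄_k = (∂f/∂x_k + i ∂f/∂y_k) / 2`. -/
def dzbar {n : ℕ} (k : Fin n) (f : Cn n → ℂ) (z : Cn n) : ℂ :=
  (1 / 2) * (fderiv ℝ f z (EuclideanSpace.single k 1)
    + Complex.I * fderiv ℝ f z (EuclideanSpace.single k Complex.I))

/-- `D_f = (f_{z_1}, …, f_{z_n}, f_{z̄_1}, …, f_{z̄_n})`, a vector of `ℂ²ⁿ` whose Euclidean norm is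
the Hilbert–Schmidt seminorm `‖D_f‖`. -/
def D {n : ℕ} (f : Cn n → ℂ) (z : Cn n) : EuclideanSpace ℂ (Fin n ⊕ Fin n) :=
  WithLp.toLp 2 (Sum.elim (fun k => dz k f z) (fun k => dzbar k f z))

/-- `D*_f`, the square root of the sum of the squared moduli of all second-order derivatives of `f`
with respect to the `z_k` and `z̄_k`. -/
def Dstar {n : ℕ} (f : Cn n → ℂ) (z : Cn n) : ℝ :=
  Real.sqrt (∑ j : Fin n, ∑ k : Fin n,
    (‖dz j (dz k f) z‖ ^ 2 + ‖dzbar j (dz k f) z‖ ^ 2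
      + ‖dz j (dzbar k f) z‖ ^ 2 + ‖dzbar j (dzbar k f) z‖ ^ 2))

/-- `f` satisfies `Δf = τ f + η Re f` on the unit ball, where `Δ` is the usual Laplacian of
`ℂⁿ = ℝ²ⁿ`, that is `Δ = ∑ₖ (∂²/∂x_k² + ∂²/∂y_k²)`. -/
def SolvesYukawa {n : ℕ} (τ η : ℝ) (f : Cn n → ℂ) : Prop :=
  ∀ z ∈ unitBall n, Laplacian.laplacian f z = (τ : ℂ) * f z + (η : ℂ) * ((f z).re : ℂ)

end

end YukawaHardy

/-! The argument studies spherical means of powers of solutions of `ΔG = T G`, where `0 ≤ ⟪w, T w⟫ ≤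
c‖w‖²`; here `T w = τ w + η Re w` and `c = τ + η`. Let `N = 2n` be the real dimension and put `φ =
(1 + ‖G‖²) ^ (p / 2)`, which is smooth in `G` even where `G` vanishes. For `p ≥ 2`, `φ` is
subharmonic and `Δφ ≤ p (p - 1) (1 + ‖G‖²) ^ (p / 2 - 1) ‖∇G‖² + p c φ`.

Let `m(r)` be the mean of `φ` over the sphere of radius `r`. Rotation invariance gives `m'' + (N -
1) m' / r = mean of Δφ` (`integral_basisLaplacian`), so `m' ≥ 0`, `m'' ≤ mean of Δφ`, and Taylor's
formula from a radius `a` bounds `m(r)` by data at `a` plus the integral of `(r - s)` times the mean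
of `Δφ` (`EnergyEstimate`).

If `κ(s)` bounds the `L^(p/2)` norm of `‖∇G‖²` on the sphere of radius `s`, Hölder's inequality and
the monotonicity of `m` reduce this to `m(r) ^ (2 / p) ≤ const + const * ∫ (r - s) κ(s) ds`; the
term `p c φ` is absorbed by taking `a` close to `1` (`powMean_rpow_le`).

This is used twice in `growth_of_hessian_bound`. For `G = ∂ₑf` the hypothesis allows `κ(s) = C / (1
- s)²`, and the integral is `O(log (1 / (1 - r)))`: this is the gradient bound. For `G = f` that
bound gives `κ(s) = A + B log (1 / (1 - s))`, and the integral is bounded: this is membership in the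
Hardy space. Since `∂ₑf` is only `C¹`, its energy estimate is obtained from difference quotients of
`f`; the estimate involves no second derivative of `G`, so it survives the limit. -/

namespace SphericalMean

open Metric Set YukawaHardy
open scoped RealInnerProductSpace Pointwise

section

/-! ### Integrals over a compact space depending on a real parameter. -/

section Parametric

variable {X : Type*} [TopologicalSpace X] [CompactSpace X] [MeasurableSpace X]
  [OpensMeasurableSpace X] {μ : Measure X} [IsFiniteMeasure μ]

theorem integrable_of_continuous_compact {F : X → ℝ} (hF : Continuous F) : Integrable F μ :=
  hF.integrable_of_hasCompactSupport (HasCompactSupport.of_compactSpace F)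

/-- Differentiation under the integral sign over a compact space. -/
theorem hasDerivAt_integral_compact {F F' : ℝ → X → ℝ} (hF : ∀ t, Continuous (F t))
    (hF' : Continuous (Function.uncurry F'))
    (h : ∀ t x, HasDerivAt (fun s => F s x) (F' t x) t) (t : ℝ) :
    HasDerivAt (fun s => ∫ x, F s x ∂μ) (∫ x, F' t x ∂μ) t := by
  have hK : IsCompact (closedBall t 1 ×ˢ (univ : Set X)) :=
    (isCompact_closedBall t 1).prod isCompact_univ
  obtain ⟨C, hC⟩ := hK.exists_bound_of_continuousOn hF'.continuousOn
  refine (hasDerivAt_integral_of_dominated_loc_of_deriv_le (bound := fun _ => C)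
    (ball_mem_nhds t one_pos) ?_ ?_ ?_ ?_ (integrable_const C) ?_).2
  · exact Eventually.of_forall fun s =>
      (integrable_of_continuous_compact (hF s)).aestronglyMeasurable
  · exact integrable_of_continuous_compact (hF t)
  · exact (integrable_of_continuous_compact
      (hF'.comp (Continuous.prodMk_right t))).aestronglyMeasurable
  · exact Eventually.of_forall fun x s hs => hC (s, x) ⟨ball_subset_closedBall hs, mem_univ x⟩
  · exact Eventually.of_forall fun x s _ => h s x

/-- Integrals over a compact space depend continuously on a parameter. -/
theorem continuous_integral_compact {F : ℝ → X → ℝ} (hF : Continuous (Function.uncurry F)) :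
    Continuous fun t => ∫ x, F t x ∂μ := by
  rw [continuous_iff_continuousAt]
  intro t
  have hK : IsCompact (closedBall t 1 ×ˢ (univ : Set X)) :=
    (isCompact_closedBall t 1).prod isCompact_univ
  obtain ⟨C, hC⟩ := hK.exists_bound_of_continuousOn hF.continuousOn
  refine continuousAt_of_dominated (bound := fun _ => C) ?_ ?_ (integrable_const C) ?_
  · exact Eventually.of_forall fun s =>
      (integrable_of_continuous_compact (hF.comp (Continuous.prodMk_right s))).aestronglyMeasurable
  · filter_upwards [closedBall_mem_nhds t one_pos] with s hs
    exact Eventually.of_forall fun x => hC (s, x) ⟨hs, mem_univ x⟩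
  · exact Eventually.of_forall fun x => (hF.comp (Continuous.prodMk_left x)).continuousAt

end Parametric

/-! ### Plane rotations and rotation invariant measures on the sphere. -/

variable {E : Type*} [NormedAddCommGroup E] [InnerProductSpace ℝ E]

/-- Infinitesimal rotation in the plane spanned by `u` and `v`. -/
noncomputable def rotGen (u v : E) : E →L[ℝ] E :=
  (innerSL ℝ u).smulRight v - (innerSL ℝ v).smulRight u

theorem rotGen_apply (u v x : E) : rotGen u v x = ⟪u, x⟫ • v - ⟪v, x⟫ • u := by
  simp [rotGen]

/-- Rotation by the angle `t` in the plane spanned by the orthonormal vectors `u` and `v`. -/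
noncomputable def planeRot (u v : E) (t : ℝ) (x : E) : E :=
  x + ((Real.cos t - 1) * ⟪u, x⟫ - Real.sin t * ⟪v, x⟫) • u
    + (Real.sin t * ⟪u, x⟫ + (Real.cos t - 1) * ⟪v, x⟫) • v

theorem norm_planeRot {u v : E} (hu : ‖u‖ = 1) (hv : ‖v‖ = 1) (huv : ⟪u, v⟫ = 0) (t : ℝ) (x : E) :
    ‖planeRot u v t x‖ = ‖x‖ := by
  rw [← sq_eq_sq₀ (norm_nonneg _) (norm_nonneg _), ← real_inner_self_eq_norm_sq,
    ← real_inner_self_eq_norm_sq]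
  have h1 : ⟪u, u⟫ = 1 := by rw [real_inner_self_eq_norm_sq, hu, one_pow]
  have h2 : ⟪v, v⟫ = 1 := by rw [real_inner_self_eq_norm_sq, hv, one_pow]
  have h3 : ⟪v, u⟫ = 0 := by rw [real_inner_comm, huv]
  simp only [planeRot, inner_add_left, inner_add_right, real_inner_smul_left,
    real_inner_smul_right, h1, h2, h3, huv, real_inner_comm x u, real_inner_comm x v]
  rw [← real_inner_comm x u, ← real_inner_comm x v]
  linear_combination (⟪u, x⟫ ^ 2 + ⟪v, x⟫ ^ 2) * Real.sin_sq_add_cos_sq t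

/-- `planeRot` as a linear isometry. -/
noncomputable def planeRotIsometry {u v : E} (hu : ‖u‖ = 1) (hv : ‖v‖ = 1) (huv : ⟪u, v⟫ = 0)
    (t : ℝ) : E →ₗᵢ[ℝ] E where
  toFun := planeRot u v t
  map_add' x y := by
    simp only [planeRot, inner_add_right]
    module
  map_smul' c x := by
    simp only [planeRot, real_inner_smul_right, RingHom.id_apply]
    module
  norm_map' x := norm_planeRot hu hv huv t x

theorem hasDerivAt_planeRot (u v : E) (t : ℝ) (x : E) :
    HasDerivAt (fun s => planeRot u v s x)
      ((-Real.sin t * ⟪u, x⟫ - Real.cos t * ⟪v, x⟫) • u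
        + (Real.cos t * ⟪u, x⟫ - Real.sin t * ⟪v, x⟫) • v) t := by
  have hc : HasDerivAt (fun s => (Real.cos s - 1) * ⟪u, x⟫ - Real.sin s * ⟪v, x⟫)
      (-Real.sin t * ⟪u, x⟫ - Real.cos t * ⟪v, x⟫) t :=
    (((Real.hasDerivAt_cos t).sub_const 1).mul_const _).sub ((Real.hasDerivAt_sin t).mul_const _)
  have hs : HasDerivAt (fun s => Real.sin s * ⟪u, x⟫ + (Real.cos s - 1) * ⟪v, x⟫)
      (Real.cos t * ⟪u, x⟫ + -Real.sin t * ⟪v, x⟫) t :=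
    ((Real.hasDerivAt_sin t).mul_const _).add (((Real.hasDerivAt_cos t).sub_const 1).mul_const _)
  have := ((hc.smul_const u).const_add x).add (hs.smul_const v)
  refine (this.congr_deriv ?_)
  congr 2
  ring

variable [FiniteDimensional ℝ E] [MeasurableSpace E] [BorelSpace E]

/-- A measure on the unit sphere that integrates continuous functions in a rotation invariant
way. -/
def RotationInvariant (σ : Measure (sphere (0 : E) 1)) : Prop :=
  ∀ (L : E ≃ₗᵢ[ℝ] E) (φ : E → ℝ), Continuous φ → ∫ ζ, φ (L (ζ : E)) ∂σ = ∫ ζ, φ (ζ : E) ∂σ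

/-- Up to a constant, the surface measure of `s` is the volume of the cone over `s`. A linear
isometry carries cones to cones and preserves volume. -/
theorem rotationInvariant_toSphere : RotationInvariant (volume : Measure E).toSphere := by
  intro L φ hφ
  have hmem : ∀ ζ : sphere (0 : E) 1, L (ζ : E) ∈ sphere (0 : E) 1 := fun ζ => by
    have := ζ.2
    simp only [mem_sphere_iff_norm, sub_zero] at this ⊢
    rw [L.norm_map, this]
  let e : sphere (0 : E) 1 → sphere (0 : E) 1 := fun ζ => ⟨L ζ, hmem ζ⟩
  have he : Continuous e := (L.continuous.comp continuous_subtype_val).subtype_mk _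
  have hpres : MeasurePreserving e (volume : Measure E).toSphere (volume : Measure E).toSphere := by
    refine ⟨he.measurable, ?_⟩
    ext s hs
    rw [Measure.map_apply he.measurable hs, Measure.toSphere_apply' _ (he.measurable hs),
      Measure.toSphere_apply' _ hs]
    congr 1
    have himg : (Ioo (0 : ℝ) 1 • ((↑) '' s) : Set E)
        = L '' (Ioo (0 : ℝ) 1 • ((↑) '' (e ⁻¹' s))) := by
      ext x
      simp only [Set.mem_smul, mem_image]
      constructor
      · rintro ⟨c, hc, _, ⟨ζ, hζ, rfl⟩, rfl⟩
        have hm : L.symm (ζ : E) ∈ sphere (0 : E) 1 := by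
          have := ζ.2
          simp only [mem_sphere_iff_norm, sub_zero] at this ⊢
          rw [L.symm.norm_map, this]
        refine ⟨c • L.symm ζ, ⟨c, hc, _, ⟨⟨_, hm⟩, ?_, rfl⟩, rfl⟩, by simp⟩
        have : e ⟨_, hm⟩ = ζ := Subtype.ext (by simp [e])
        simpa [this] using hζ
      · rintro ⟨_, ⟨c, hc, _, ⟨ζ, hζ, rfl⟩, rfl⟩, rfl⟩
        exact ⟨c, hc, _, ⟨e ζ, hζ, rfl⟩, by simp [e]⟩
    rw [himg, L.image_eq_preimage_symm]
    exact ((L.symm.measurePreserving).measure_preimage_equiv (f := L.symm.toMeasurableEquiv) _).symm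
  have hφm : AEStronglyMeasurable (fun ζ : sphere (0 : E) 1 => φ ζ)
      (Measure.map e (volume : Measure E).toSphere) :=
    (hφ.comp continuous_subtype_val).aestronglyMeasurable
  have := integral_map he.measurable.aemeasurable hφm
  rw [hpres.map_eq] at this
  exact this.symm

omit [FiniteDimensional ℝ E] [BorelSpace E] in
theorem RotationInvariant.smul {σ : Measure (sphere (0 : E) 1)} (h : RotationInvariant σ)
    (c : ENNReal) : RotationInvariant (c • σ) := by
  intro L φ hφ
  rw [integral_smul_measure, integral_smul_measure, h L φ hφ]

variable {σ : Measure (sphere (0 : E) 1)} [IsFiniteMeasure σ]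

/-- The derivative of a function along an infinitesimal rotation has mean zero on spheres. -/
theorem integral_fderiv_rotGen (hσ : RotationInvariant σ) {φ : E → ℝ} (hφ : ContDiff ℝ 1 φ)
    {u v : E} (hu : ‖u‖ = 1) (hv : ‖v‖ = 1) (huv : ⟪u, v⟫ = 0) (r : ℝ) :
    ∫ ζ : sphere (0 : E) 1, fderiv ℝ φ (r • (ζ : E)) (rotGen u v (r • (ζ : E))) ∂σ = 0 := by
  have hd := hφ.continuous_fderiv one_ne_zero
  have key := hasDerivAt_integral_compact (μ := σ)
    (F := fun t (ζ : sphere (0 : E) 1) => φ (planeRot u v t (r • (ζ : E))))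
    (F' := fun t (ζ : sphere (0 : E) 1) => fderiv ℝ φ (planeRot u v t (r • (ζ : E)))
      ((-Real.sin t * ⟪u, r • (ζ : E)⟫ - Real.cos t * ⟪v, r • (ζ : E)⟫) • u
        + (Real.cos t * ⟪u, r • (ζ : E)⟫ - Real.sin t * ⟪v, r • (ζ : E)⟫) • v))
    (fun t => by
      have := hφ.continuous
      unfold planeRot
      fun_prop)
    (by
      unfold planeRot Function.uncurry
      fun_prop)
    (fun t ζ => by
      exact ((hφ.differentiable one_ne_zero _).hasFDerivAt.comp_hasDerivAt t
        (hasDerivAt_planeRot u v t (r • (ζ : E))))) 0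
  -- Rotating by `t` does not change the mean, so the derivative at `t = 0` computed in `key` must
  -- vanish.
  have hconst : (fun t => ∫ ζ : sphere (0 : E) 1, φ (planeRot u v t (r • (ζ : E))) ∂σ)
      = fun _ => ∫ ζ : sphere (0 : E) 1, φ (r • (ζ : E)) ∂σ := by
    funext t
    have := hσ ((planeRotIsometry hu hv huv t).toLinearIsometryEquiv rfl) (fun x => φ (r • x))
      (hφ.continuous.comp (continuous_const_smul r))
    rw [← this]
    refine integral_congr_ae (Eventually.of_forall fun ζ => ?_)
    show φ _ = φ _
    rw [← map_smul]
    rfl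
  rw [hconst] at key
  have := key.unique (hasDerivAt_const (0 : ℝ) _)
  rw [← this]
  refine integral_congr_ae (Eventually.of_forall fun ζ => ?_)
  have h0 : planeRot u v 0 (r • (ζ : E)) = r • (ζ : E) := by simp [planeRot]
  simp only [h0, rotGen_apply, Real.sin_zero, Real.cos_zero]
  congr 1
  module

end

/-! ### The mean of the Laplacian in polar coordinates. -/

section

section Trace

variable {E : Type*} [NormedAddCommGroup E] [InnerProductSpace ℝ E] {ι : Type*} [Fintype ι]
  {G : Type*} [NormedAddCommGroup G] [NormedSpace ℝ G]

/-- The sum of the second derivatives along an orthonormal basis. -/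
noncomputable def basisLaplacian (b : OrthonormalBasis ι ℝ E) (φ : E → G) (x : E) : G :=
  ∑ i, fderiv ℝ (fderiv ℝ φ) x (b i) (b i)

/-- Second order part of the sum of squares of all rotation fields: with `B` the Hessian it leaves
the tangential part of the trace. The factor `2` appears because each plane is counted for `(i, j)`
and `(j, i)`. -/
theorem sum_rotGen_bilinear (b : OrthonormalBasis ι ℝ E) (B : E →L[ℝ] E →L[ℝ] ℝ) (x : E) :
    ∑ i, ∑ j, B (rotGen (b i) (b j) x) (rotGen (b i) (b j) x)
      = 2 * (‖x‖ ^ 2 * ∑ i, B (b i) (b i) - B x x) := by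
  have hx : B x x = ∑ i, ∑ j, ⟪b i, x⟫ * ⟪b j, x⟫ * B (b i) (b j) := by
    conv_lhs => rw [← b.sum_repr' x]
    simp only [map_sum, map_smul, _root_.sum_apply, _root_.smul_apply,
      smul_eq_mul, Finset.mul_sum]
    rw [Finset.sum_comm]
    refine Finset.sum_congr rfl fun i _ => Finset.sum_congr rfl fun j _ => ?_
    ring
  have hx' : B x x = ∑ i, ∑ j, ⟪b i, x⟫ * ⟪b j, x⟫ * B (b j) (b i) := by
    rw [hx, Finset.sum_comm]
    refine Finset.sum_congr rfl fun i _ => Finset.sum_congr rfl fun j _ => ?_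
    ring
  have hn : ‖x‖ ^ 2 = ∑ i, ⟪b i, x⟫ ^ 2 := by
    rw [← b.sum_sq_norm_inner_right x]
    simp
  have e1 : ‖x‖ ^ 2 * ∑ i, B (b i) (b i) = ∑ i, ∑ j, ⟪b i, x⟫ ^ 2 * B (b j) (b j) := by
    rw [hn, Finset.sum_mul_sum]
  have e2 : ‖x‖ ^ 2 * ∑ i, B (b i) (b i) = ∑ i, ∑ j, ⟪b j, x⟫ ^ 2 * B (b i) (b i) := by
    rw [e1, Finset.sum_comm]
  have : 2 * (‖x‖ ^ 2 * ∑ i, B (b i) (b i) - B x x) =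
      (∑ i, ∑ j, ⟪b i, x⟫ ^ 2 * B (b j) (b j)) + (∑ i, ∑ j, ⟪b j, x⟫ ^ 2 * B (b i) (b i))
      - (∑ i, ∑ j, ⟪b i, x⟫ * ⟪b j, x⟫ * B (b i) (b j))
      - ∑ i, ∑ j, ⟪b i, x⟫ * ⟪b j, x⟫ * B (b j) (b i) := by
    rw [← hx, ← hx', ← e1, ← e2]; ring
  rw [this]
  simp only [← Finset.sum_add_distrib, ← Finset.sum_sub_distrib]
  refine Finset.sum_congr rfl fun i _ => Finset.sum_congr rfl fun j _ => ?_
  simp only [rotGen_apply, map_sub, map_smul, _root_.sub_apply,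
    _root_.smul_apply, smul_eq_mul]
  ring

/-- First order part of the same sum. For `i ≠ j` the squared generator is minus the projection onto
the plane of `b i` and `b j`, and each basis direction lies in `card ι - 1` such planes, each
counted twice. -/
theorem sum_rotGen_rotGen (b : OrthonormalBasis ι ℝ E) (x : E) :
    ∑ i, ∑ j, rotGen (b i) (b j) (rotGen (b i) (b j) x)
      = (-2 * ((Fintype.card ι : ℝ) - 1)) • x := by
  classical
  have hterm : ∀ i j, rotGen (b i) (b j) (rotGen (b i) (b j) x)
      = ((if i = j then ⟪b i, x⟫ • b j else 0) + (if i = j then ⟪b j, x⟫ • b i else 0))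
        - (⟪b j, x⟫ • b j + ⟪b i, x⟫ • b i) := by
    intro i j
    have hij : ⟪b j, b i⟫ = if j = i then (1 : ℝ) else 0 := by
      rw [orthonormal_iff_ite.mp b.orthonormal]
    simp only [rotGen_apply, inner_sub_right, real_inner_smul_right, b.norm_eq_one,
      real_inner_self_eq_norm_sq, hij, real_inner_comm (b j) (b i)]
    by_cases h : i = j
    · subst h; simp
    · simp [h, Ne.symm h]; module
  simp only [hterm, Finset.sum_sub_distrib, Finset.sum_add_distrib, Finset.sum_ite_eq,
    Finset.mem_univ, if_true, b.sum_repr', Finset.sum_const, Finset.card_univ,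
    ← Finset.smul_sum]
  rw [← Nat.cast_smul_eq_nsmul ℝ]
  module

end Trace

variable {E : Type*} [NormedAddCommGroup E] [InnerProductSpace ℝ E] [FiniteDimensional ℝ E]
  [MeasurableSpace E] [BorelSpace E] {σ : Measure (sphere (0 : E) 1)} [IsFiniteMeasure σ]
  {ι : Type*} [Fintype ι]

/-- The integrand is the second derivative of `φ` along one rotation field, so
`integral_fderiv_rotGen` applies to the first such derivative. For `i = j` the generator is zero. -/
theorem integral_hessian_rotGen (hσ : RotationInvariant σ) {φ : E → ℝ} (hφ : ContDiff ℝ 2 φ)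
    (b : OrthonormalBasis ι ℝ E) (i j : ι) (r : ℝ) :
    ∫ ζ : sphere (0 : E) 1, (fderiv ℝ (fderiv ℝ φ) (r • (ζ : E)) (rotGen (b i) (b j) (r • (ζ : E)))
        (rotGen (b i) (b j) (r • (ζ : E)))
      + fderiv ℝ φ (r • (ζ : E)) (rotGen (b i) (b j) (rotGen (b i) (b j) (r • (ζ : E))))) ∂σ
      = 0 := by
  by_cases hij : i = j
  · subst hij
    simp [rotGen_apply]
  have hφ1 : ContDiff ℝ 1 (fderiv ℝ φ) := hφ.fderiv_right (by norm_num)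
  have hψ : ContDiff ℝ 1 (fun x => fderiv ℝ φ x (rotGen (b i) (b j) x)) :=
    hφ1.clm_apply (rotGen (b i) (b j)).contDiff
  have h0 : ⟪b i, b j⟫ = 0 := b.orthonormal.2 hij
  rw [← integral_fderiv_rotGen hσ hψ (b.norm_eq_one i) (b.norm_eq_one j) h0 r]
  refine integral_congr_ae (Eventually.of_forall fun ζ => ?_)
  have := ((hφ1.differentiable one_ne_zero (r • (ζ : E))).hasFDerivAt.clm_apply
    (rotGen (b i) (b j)).hasFDerivAt).fderiv
  simp only [this]
  simp
  ring

omit [FiniteDimensional ℝ E] [MeasurableSpace E] [BorelSpace E] in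
theorem continuous_hessian {φ : E → ℝ} (hφ : ContDiff ℝ 2 φ) :
    Continuous (fderiv ℝ (fderiv ℝ φ)) :=
  (hφ.fderiv_right (m := 1) (by norm_num)).continuous_fderiv one_ne_zero

/-- The mean of the Laplacian over a sphere in polar coordinates. -/
theorem integral_basisLaplacian (hσ : RotationInvariant σ) {φ : E → ℝ} (hφ : ContDiff ℝ 2 φ)
    (b : OrthonormalBasis ι ℝ E) (r : ℝ) :
    r ^ 2 * ∫ ζ : sphere (0 : E) 1, basisLaplacian b φ (r • (ζ : E)) ∂σ
      = r ^ 2 * ∫ ζ : sphere (0 : E) 1, fderiv ℝ (fderiv ℝ φ) (r • (ζ : E)) (ζ : E) (ζ : E) ∂σ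
        + ((Fintype.card ι : ℝ) - 1) * r
          * ∫ ζ : sphere (0 : E) 1, fderiv ℝ φ (r • (ζ : E)) (ζ : E) ∂σ := by
  have hd : Continuous (fderiv ℝ φ) := hφ.continuous_fderiv two_ne_zero
  have hdd := continuous_hessian hφ
  have hsum : ∑ i, ∑ j, ∫ ζ : sphere (0 : E) 1, (fderiv ℝ (fderiv ℝ φ) (r • (ζ : E))
        (rotGen (b i) (b j) (r • (ζ : E))) (rotGen (b i) (b j) (r • (ζ : E)))
      + fderiv ℝ φ (r • (ζ : E)) (rotGen (b i) (b j) (rotGen (b i) (b j) (r • (ζ : E))))) ∂σ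
      = 0 :=
    Finset.sum_eq_zero fun i _ => Finset.sum_eq_zero fun j _ => integral_hessian_rotGen hσ hφ b i j r
  have hint : ∀ i j, Integrable (fun ζ : sphere (0 : E) 1 => (fderiv ℝ (fderiv ℝ φ) (r • (ζ : E))
        (rotGen (b i) (b j) (r • (ζ : E))) (rotGen (b i) (b j) (r • (ζ : E)))
      + fderiv ℝ φ (r • (ζ : E)) (rotGen (b i) (b j) (rotGen (b i) (b j) (r • (ζ : E)))))) σ :=
    fun i j => integrable_of_continuous_compact (by fun_prop)
  simp only [← integral_finsetSum _ fun j _ => hint _ j] at hsum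
  rw [← integral_finsetSum _ fun i _ => integrable_finsetSum _ fun j _ => hint i j] at hsum
  have hpt : ∀ ζ : sphere (0 : E) 1, ∑ i, ∑ j, (fderiv ℝ (fderiv ℝ φ) (r • (ζ : E))
        (rotGen (b i) (b j) (r • (ζ : E))) (rotGen (b i) (b j) (r • (ζ : E)))
      + fderiv ℝ φ (r • (ζ : E)) (rotGen (b i) (b j) (rotGen (b i) (b j) (r • (ζ : E)))))
      = (2 * r ^ 2) * basisLaplacian b φ (r • (ζ : E))
        - ((2 * r ^ 2) * fderiv ℝ (fderiv ℝ φ) (r • (ζ : E)) (ζ : E) (ζ : E)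
        + (2 * ((Fintype.card ι : ℝ) - 1) * r) * fderiv ℝ φ (r • (ζ : E)) (ζ : E)) := by
    intro ζ
    have hζ : ‖(ζ : E)‖ = 1 := by simp
    simp only [Finset.sum_add_distrib]
    rw [sum_rotGen_bilinear b]
    simp only [← map_sum]
    rw [sum_rotGen_rotGen b, norm_smul, hζ]
    simp only [basisLaplacian, map_smul, _root_.smul_apply, smul_eq_mul, mul_one,
      Real.norm_eq_abs, sq_abs]
    ring
  simp only [hpt] at hsum
  have hlap : Continuous fun ζ : sphere (0 : E) 1 => basisLaplacian b φ (r • (ζ : E)) := by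
    unfold basisLaplacian
    fun_prop
  have hA := integrable_of_continuous_compact (μ := σ) (hlap.const_mul (2 * r ^ 2))
  have hB := integrable_of_continuous_compact (μ := σ) (F := fun ζ : sphere (0 : E) 1 =>
    (2 * r ^ 2) * fderiv ℝ (fderiv ℝ φ) (r • (ζ : E)) (ζ : E) (ζ : E)) (by fun_prop)
  have hC := integrable_of_continuous_compact (μ := σ) (F := fun ζ : sphere (0 : E) 1 =>
    (2 * ((Fintype.card ι : ℝ) - 1) * r) * fderiv ℝ φ (r • (ζ : E)) (ζ : E)) (by fun_prop)
  have hBC := integral_sub hA (hB.add hC)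
  simp only [Pi.add_apply] at hBC
  rw [hBC, integral_add hB hC, integral_const_mul, integral_const_mul,
    integral_const_mul] at hsum
  linarith

theorem hasDerivAt_mean {φ : E → ℝ} (hφ : ContDiff ℝ 1 φ) (r : ℝ) :
    HasDerivAt (fun s : ℝ => ∫ ζ : sphere (0 : E) 1, φ (s • (ζ : E)) ∂σ)
      (∫ ζ : sphere (0 : E) 1, fderiv ℝ φ (r • (ζ : E)) (ζ : E) ∂σ) r := by
  have hc := hφ.continuous
  have hd := hφ.continuous_fderiv one_ne_zero
  refine hasDerivAt_integral_compact (F := fun s (ζ : sphere (0 : E) 1) => φ (s • (ζ : E)))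
    (F' := fun s (ζ : sphere (0 : E) 1) => fderiv ℝ φ (s • (ζ : E)) (ζ : E))
    (fun t => by fun_prop) (by unfold Function.uncurry; fun_prop) (fun t ζ => ?_) r
  have h := (hasDerivAt_id t).smul_const (ζ : E)
  rw [one_smul] at h
  exact (hφ.differentiable one_ne_zero _).hasFDerivAt.comp_hasDerivAt t h

theorem hasDerivAt_mean_fderiv {φ : E → ℝ} (hφ : ContDiff ℝ 2 φ) (r : ℝ) :
    HasDerivAt (fun s : ℝ => ∫ ζ : sphere (0 : E) 1, fderiv ℝ φ (s • (ζ : E)) (ζ : E) ∂σ)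
      (∫ ζ : sphere (0 : E) 1, fderiv ℝ (fderiv ℝ φ) (r • (ζ : E)) (ζ : E) (ζ : E) ∂σ) r := by
  have hφ1 : ContDiff ℝ 1 (fderiv ℝ φ) := hφ.fderiv_right (by norm_num)
  have hd := hφ1.continuous
  have hdd := continuous_hessian hφ
  refine hasDerivAt_integral_compact
    (F := fun s (ζ : sphere (0 : E) 1) => fderiv ℝ φ (s • (ζ : E)) (ζ : E))
    (F' := fun s (ζ : sphere (0 : E) 1) => fderiv ℝ (fderiv ℝ φ) (s • (ζ : E)) (ζ : E) (ζ : E))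
    (fun t => by fun_prop) (by unfold Function.uncurry; fun_prop) (fun t ζ => ?_) r
  have h := (hasDerivAt_id t).smul_const (ζ : E)
  rw [one_smul] at h
  have h1 : HasDerivAt (fun s : ℝ => fderiv ℝ φ (s • (ζ : E)))
      (fderiv ℝ (fderiv ℝ φ) (t • (ζ : E)) (ζ : E)) t :=
    (hφ1.differentiable one_ne_zero _).hasFDerivAt.comp_hasDerivAt t h
  simpa using h1.clm_apply (hasDerivAt_const t (ζ : E))

end

section

/-! ### Spherical means of subharmonic functions. -/

section Growth

variable {E : Type*} [NormedAddCommGroup E] [InnerProductSpace ℝ E] [FiniteDimensional ℝ E]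
  [MeasurableSpace E] [BorelSpace E] {σ : Measure (sphere (0 : E) 1)} [IsFiniteMeasure σ]
  {ι : Type*} [Fintype ι]

/-- Spherical means of a subharmonic function have nonnegative radial derivative. -/
theorem mean_fderiv_nonneg (hσ : RotationInvariant σ) {φ : E → ℝ} (hφ : ContDiff ℝ 2 φ)
    (b : OrthonormalBasis ι ℝ E) (hι : 2 ≤ Fintype.card ι) {R : ℝ}
    (hsub : ∀ x ∈ ball (0 : E) R, 0 ≤ basisLaplacian b φ x) {r : ℝ} (hr : r ∈ Ioo 0 R) :
    0 ≤ ∫ ζ : sphere (0 : E) 1, fderiv ℝ φ (r • (ζ : E)) (ζ : E) ∂σ := by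
  -- With `N = card ι = k + 2`, the weight `s ^ (k + 1)` is `s ^ (N - 1)`, and the derivative of `s
  -- ^ (N - 1) m'` is `s ^ (N - 1)` times the mean of the Laplacian.
  obtain ⟨k, hk⟩ := Nat.exists_eq_add_of_le' hι
  set m' : ℝ → ℝ := fun s => ∫ ζ : sphere (0 : E) 1, fderiv ℝ φ (s • (ζ : E)) (ζ : E) ∂σ with hm'
  have hder : ∀ s, HasDerivAt (fun s => s ^ (k + 1) * m' s)
      ((k + 1 : ℕ) * s ^ k * m' s + s ^ (k + 1)
        * ∫ ζ : sphere (0 : E) 1, fderiv ℝ (fderiv ℝ φ) (s • (ζ : E)) (ζ : E) (ζ : E) ∂σ) s :=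
    fun s => (hasDerivAt_pow (k + 1) s).mul (hasDerivAt_mean_fderiv hφ s)
  have hmono : MonotoneOn (fun s => s ^ (k + 1) * m' s) (Icc 0 r) := by
    refine monotoneOn_of_deriv_nonneg (convex_Icc 0 r)
      (fun s _ => (hder s).continuousAt.continuousWithinAt)
      (fun s _ => (hder s).differentiableAt.differentiableWithinAt) fun s hs => ?_
    rw [interior_Icc] at hs
    rw [(hder s).deriv]
    have hA : 0 ≤ ∫ ζ : sphere (0 : E) 1, basisLaplacian b φ (s • (ζ : E)) ∂σ := by
      refine integral_nonneg fun ζ => hsub _ ?_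
      rw [mem_ball_zero_iff, norm_smul]
      simpa [abs_of_pos hs.1] using hs.2.trans hr.2
    have h := integral_basisLaplacian hσ hφ b s
    rw [hk] at h
    have h2 : s * ((k + 1 : ℕ) * s ^ k * m' s + s ^ (k + 1)
        * ∫ ζ : sphere (0 : E) 1, fderiv ℝ (fderiv ℝ φ) (s • (ζ : E)) (ζ : E) (ζ : E) ∂σ)
        = s ^ k * (s ^ 2 * ∫ ζ : sphere (0 : E) 1, basisLaplacian b φ (s • (ζ : E)) ∂σ) := by
      rw [h]
      push_cast
      ring
    have h3 : 0 ≤ s ^ k * (s ^ 2 * ∫ ζ : sphere (0 : E) 1, basisLaplacian b φ (s • (ζ : E)) ∂σ) :=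
      mul_nonneg (pow_nonneg hs.1.le _) (mul_nonneg (sq_nonneg _) hA)
    rw [← h2] at h3
    exact nonneg_of_mul_nonneg_right h3 hs.1
  have := hmono (left_mem_Icc.2 hr.1.le) (right_mem_Icc.2 hr.1.le) hr.1.le
  simp only [zero_pow (Nat.succ_ne_zero k), zero_mul] at this
  exact nonneg_of_mul_nonneg_right this (pow_pos hr.1 _)

theorem mean_mono (hσ : RotationInvariant σ) {φ : E → ℝ} (hφ : ContDiff ℝ 2 φ)
    (b : OrthonormalBasis ι ℝ E) (hι : 2 ≤ Fintype.card ι) {R : ℝ}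
    (hsub : ∀ x ∈ ball (0 : E) R, 0 ≤ basisLaplacian b φ x) {a r : ℝ} (ha : 0 < a) (har : a ≤ r)
    (hr : r < R) :
    ∫ ζ : sphere (0 : E) 1, φ (a • (ζ : E)) ∂σ ≤ ∫ ζ : sphere (0 : E) 1, φ (r • (ζ : E)) ∂σ := by
  have hder := fun s : ℝ => hasDerivAt_mean (σ := σ) (hφ.of_le one_le_two) s
  have hmono : MonotoneOn (fun s : ℝ => ∫ ζ : sphere (0 : E) 1, φ (s • (ζ : E)) ∂σ) (Icc a r) := by
    refine monotoneOn_of_deriv_nonneg (convex_Icc a r)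
      (fun s _ => (hder s).continuousAt.continuousWithinAt)
      (fun s _ => (hder s).differentiableAt.differentiableWithinAt) fun s hs => ?_
    rw [interior_Icc] at hs
    rw [(hder s).deriv]
    exact mean_fderiv_nonneg hσ hφ b hι hsub ⟨ha.trans hs.1, hs.2.trans hr⟩
  exact hmono (left_mem_Icc.2 har) (right_mem_Icc.2 har) har

/-- Taylor estimate for the spherical means of a subharmonic function. -/
theorem mean_le_taylor (hσ : RotationInvariant σ) {φ : E → ℝ} (hφ : ContDiff ℝ 2 φ)
    (b : OrthonormalBasis ι ℝ E) (hι : 2 ≤ Fintype.card ι) {R : ℝ}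
    (hsub : ∀ x ∈ ball (0 : E) R, 0 ≤ basisLaplacian b φ x) {B : ℝ → ℝ} (hB : Continuous B)
    {a r : ℝ} (ha : 0 < a) (har : a ≤ r) (hr : r < R)
    (hle : ∀ s ∈ Icc a r, ∫ ζ : sphere (0 : E) 1, basisLaplacian b φ (s • (ζ : E)) ∂σ ≤ B s) :
    ∫ ζ : sphere (0 : E) 1, φ (r • (ζ : E)) ∂σ ≤ ∫ ζ : sphere (0 : E) 1, φ (a • (ζ : E)) ∂σ
      + (r - a) * (∫ ζ : sphere (0 : E) 1, fderiv ℝ φ (a • (ζ : E)) (ζ : E) ∂σ)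
      + ∫ s in a..r, (r - s) * B s := by
  set m : ℝ → ℝ := fun s => ∫ ζ : sphere (0 : E) 1, φ (s • (ζ : E)) ∂σ
  set m' : ℝ → ℝ := fun s => ∫ ζ : sphere (0 : E) 1, fderiv ℝ φ (s • (ζ : E)) (ζ : E) ∂σ
  set m'' : ℝ → ℝ := fun s =>
    ∫ ζ : sphere (0 : E) 1, fderiv ℝ (fderiv ℝ φ) (s • (ζ : E)) (ζ : E) (ζ : E) ∂σ
  have hm''c : Continuous m'' := by
    have hdd := continuous_hessian hφ
    exact continuous_integral_compact (F := fun s (ζ : sphere (0 : E) 1) =>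
      fderiv ℝ (fderiv ℝ φ) (s • (ζ : E)) (ζ : E) (ζ : E)) (by unfold Function.uncurry; fun_prop)
  -- Integrating this derivative over `[a, r]` gives Taylor's formula with integral remainder.
  have hder : ∀ s, HasDerivAt (fun s => m s + (r - s) * m' s) ((r - s) * m'' s) s := by
    intro s
    have h1 := hasDerivAt_mean (σ := σ) (hφ.of_le one_le_two) s
    have h2 := hasDerivAt_mean_fderiv (σ := σ) hφ s
    refine (h1.add (((hasDerivAt_id s).const_sub r).mul h2)).congr_deriv ?_
    simp only [id]
    ring
  have hftc := intervalIntegral.integral_eq_sub_of_hasDerivAt (a := a) (b := r)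
    (fun s _ => hder s) (Continuous.intervalIntegrable (by fun_prop) _ _)
  have hmono : ∫ s in a..r, (r - s) * m'' s ≤ ∫ s in a..r, (r - s) * B s := by
    refine intervalIntegral.integral_mono_on har (Continuous.intervalIntegrable (by fun_prop) _ _)
      (Continuous.intervalIntegrable (by fun_prop) _ _) fun s hs => ?_
    refine mul_le_mul_of_nonneg_left ?_ (sub_nonneg.2 hs.2)
    have hs0 : 0 < s := ha.trans_le hs.1
    have h := integral_basisLaplacian hσ hφ b s
    have h' : 0 ≤ m' s := mean_fderiv_nonneg hσ hφ b hι hsub ⟨hs0, hs.2.trans_lt hr⟩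
    have hc : (0 : ℝ) ≤ (Fintype.card ι : ℝ) - 1 := by
      have : (2 : ℝ) ≤ Fintype.card ι := by exact_mod_cast hι
      linarith
    refine le_trans ?_ (hle s hs)
    -- The first order term of the polar formula is nonnegative because `m' ≥ 0`, so it may be
    -- dropped.
    have h3 : s ^ 2 * m'' s
        ≤ s ^ 2 * ∫ ζ : sphere (0 : E) 1, basisLaplacian b φ (s • (ζ : E)) ∂σ := by
      rw [h]
      exact le_add_of_nonneg_right (mul_nonneg (mul_nonneg hc hs0.le) h')
    exact le_of_mul_le_mul_left h3 (by positivity)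
  simp only [sub_self, zero_mul, add_zero] at hftc
  linarith

end Growth

/-! ### The Laplacian of a smoothed power of a vector valued function. -/

section Power

variable {E : Type*} [NormedAddCommGroup E] [InnerProductSpace ℝ E]
  {F : Type*} [NormedAddCommGroup F] [InnerProductSpace ℝ F]

/-- The smooth substitute `(1 + ‖G‖²) ^ (p / 2)` for `‖G‖ ^ p`. -/
noncomputable def smoothPow (p : ℝ) (G : E → F) (x : E) : ℝ := (1 + ‖G x‖ ^ 2) ^ (p / 2)

omit [InnerProductSpace ℝ F] in
theorem one_add_norm_sq_pos (w : F) : 0 < 1 + ‖w‖ ^ 2 := by positivity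

theorem contDiff_smoothPow {k : ℕ∞} (p : ℝ) {G : E → F} (hG : ContDiff ℝ k G) :
    ContDiff ℝ k (smoothPow p G) :=
  (contDiff_const.add (hG.norm_sq ℝ)).rpow_const_of_ne fun x => (one_add_norm_sq_pos (G x)).ne'

theorem hasDerivAt_one_add_norm_sq_rpow {γ : ℝ → F} {γ' : F} {t : ℝ} (h : HasDerivAt γ γ' t)
    (e : ℝ) : HasDerivAt (fun s => (1 + ‖γ s‖ ^ 2) ^ e)
      (2 * e * (1 + ‖γ t‖ ^ 2) ^ (e - 1) * ⟪γ t, γ'⟫) t := by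
  refine ((h.norm_sq.const_add 1).rpow_const (Or.inl (one_add_norm_sq_pos _).ne')).congr_deriv ?_
  ring

theorem hasDerivAt_comp_line {G : Type*} [NormedAddCommGroup G] [NormedSpace ℝ G] {f : E → G}
    {x v : E} {t : ℝ} (hf : DifferentiableAt ℝ f (x + t • v)) :
    HasDerivAt (fun s : ℝ => f (x + s • v)) (fderiv ℝ f (x + t • v) v) t := by
  have h := ((hasDerivAt_id t).smul_const v).const_add x
  rw [one_smul] at h
  exact hf.hasFDerivAt.comp_hasDerivAt t h

theorem fderiv_smoothPow_apply (p : ℝ) {G : E → F} (hG : ContDiff ℝ 1 G) (x v : E) :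
    fderiv ℝ (smoothPow p G) x v
      = p * (1 + ‖G x‖ ^ 2) ^ (p / 2 - 1) * ⟪G x, fderiv ℝ G x v⟫ := by
  have h1 := hasDerivAt_comp_line (x := x) (v := v) (t := 0)
    ((contDiff_smoothPow (k := 1) p hG).differentiable one_ne_zero _)
  have h2 := hasDerivAt_one_add_norm_sq_rpow (hasDerivAt_comp_line (x := x) (v := v) (t := 0)
    (hG.differentiable one_ne_zero _)) (p / 2)
  have := h1.unique h2
  simp only [zero_smul, add_zero] at this
  rw [this]
  ring

/-- Restricting to the line `x + t v` reduces the claim to differentiating the formula for the first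
derivative in one variable. -/
theorem hessian_smoothPow_apply (p : ℝ) {G : E → F} (hG : ContDiff ℝ 2 G) (x v : E) :
    fderiv ℝ (fderiv ℝ (smoothPow p G)) x v v
      = p * (1 + ‖G x‖ ^ 2) ^ (p / 2 - 1)
          * (‖fderiv ℝ G x v‖ ^ 2 + ⟪G x, fderiv ℝ (fderiv ℝ G) x v v⟫)
        + p * (p - 2) * (1 + ‖G x‖ ^ 2) ^ (p / 2 - 2) * ⟪G x, fderiv ℝ G x v⟫ ^ 2 := by
  have hG1 : ContDiff ℝ 1 G := hG.of_le one_le_two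
  have hφ1 : ContDiff ℝ 1 (fderiv ℝ (smoothPow p G)) :=
    (contDiff_smoothPow (k := 2) p hG).fderiv_right (m := 1) (by norm_num)
  have hdG : ContDiff ℝ 1 (fderiv ℝ G) := hG.fderiv_right (by norm_num)
  have h1 := (hasDerivAt_comp_line (x := x) (v := v) (t := 0)
    (hφ1.differentiable one_ne_zero _)).clm_apply (hasDerivAt_const (0 : ℝ) v)
  have hg := hasDerivAt_comp_line (x := x) (v := v) (t := 0) (hG1.differentiable one_ne_zero _)
  have hdg := (hasDerivAt_comp_line (x := x) (v := v) (t := 0)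
    (hdG.differentiable one_ne_zero _)).clm_apply (hasDerivAt_const (0 : ℝ) v)
  have h2 := ((hasDerivAt_one_add_norm_sq_rpow hg (p / 2 - 1)).const_mul p).mul (hg.inner ℝ hdg)
  simp only [fderiv_smoothPow_apply p hG1] at h1
  have := h1.unique h2
  simp only [zero_smul, add_zero, map_zero, real_inner_self_eq_norm_sq, inner_zero_right,
    mul_zero] at this
  rw [this, show p / 2 - 1 - 1 = p / 2 - 2 by ring]
  ring

variable {ι : Type*} [Fintype ι]

/-- The squared norm of the gradient in an orthonormal basis. -/
noncomputable def gradSq (b : OrthonormalBasis ι ℝ E) (G : E → F) (x : E) : ℝ :=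
  ∑ i, ‖fderiv ℝ G x (b i)‖ ^ 2

theorem gradSq_nonneg (b : OrthonormalBasis ι ℝ E) (G : E → F) (x : E) : 0 ≤ gradSq b G x :=
  Finset.sum_nonneg fun _ _ => sq_nonneg _

theorem basisLaplacian_smoothPow (p : ℝ) {G : E → F} (hG : ContDiff ℝ 2 G)
    (b : OrthonormalBasis ι ℝ E) (x : E) :
    basisLaplacian b (smoothPow p G) x
      = p * (1 + ‖G x‖ ^ 2) ^ (p / 2 - 1) * (gradSq b G x + ⟪G x, basisLaplacian b G x⟫)
        + p * (p - 2) * (1 + ‖G x‖ ^ 2) ^ (p / 2 - 2) * ∑ i, ⟪G x, fderiv ℝ G x (b i)⟫ ^ 2 := by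
  simp only [basisLaplacian, gradSq, hessian_smoothPow_apply p hG, Finset.sum_add_distrib,
    inner_sum, ← Finset.mul_sum]

theorem basisLaplacian_smoothPow_nonneg {p : ℝ} (hp : 2 ≤ p) {G : E → F} (hG : ContDiff ℝ 2 G)
    (b : OrthonormalBasis ι ℝ E) {x : E} (h : 0 ≤ ⟪G x, basisLaplacian b G x⟫) :
    0 ≤ basisLaplacian b (smoothPow p G) x := by
  rw [basisLaplacian_smoothPow p hG]
  have := one_add_norm_sq_pos (G x)
  have := gradSq_nonneg b G x
  have : 0 ≤ p - 2 := by linarith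
  have : 0 ≤ p := by linarith
  have : 0 ≤ ∑ i, ⟪G x, fderiv ℝ G x (b i)⟫ ^ 2 := Finset.sum_nonneg fun _ _ => sq_nonneg _
  positivity

/-- By Cauchy–Schwarz the last sum in `basisLaplacian_smoothPow` is at most `(1 + ‖G‖²) * gradSq`,
so the two gradient coefficients add up to `p + p (p - 2) = p (p - 1)`. -/
theorem basisLaplacian_smoothPow_le {p c : ℝ} (hp : 2 ≤ p) {G : E → F} (hG : ContDiff ℝ 2 G)
    (b : OrthonormalBasis ι ℝ E) {x : E} (hc : 0 ≤ c)
    (h : ⟪G x, basisLaplacian b G x⟫ ≤ c * ‖G x‖ ^ 2) :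
    basisLaplacian b (smoothPow p G) x
      ≤ p * (p - 1) * ((1 + ‖G x‖ ^ 2) ^ (p / 2 - 1) * gradSq b G x) + p * c * smoothPow p G x := by
  rw [basisLaplacian_smoothPow p hG, smoothPow]
  set q := 1 + ‖G x‖ ^ 2 with hq
  have hq0 : 0 < q := one_add_norm_sq_pos (G x)
  have hqq : q ^ (p / 2) = q ^ (p / 2 - 1) * q := by
    rw [← Real.rpow_add_one hq0.ne']; ring_nf
  have hqq' : q ^ (p / 2 - 1) = q ^ (p / 2 - 2) * q := by
    rw [← Real.rpow_add_one hq0.ne']; ring_nf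
  have h1 : ∑ i, ⟪G x, fderiv ℝ G x (b i)⟫ ^ 2 ≤ q * gradSq b G x := by
    rw [gradSq, Finset.mul_sum]
    refine Finset.sum_le_sum fun i _ => ?_
    have h2 := abs_real_inner_le_norm (G x) (fderiv ℝ G x (b i))
    calc ⟪G x, fderiv ℝ G x (b i)⟫ ^ 2 ≤ (‖G x‖ * ‖fderiv ℝ G x (b i)‖) ^ 2 := sq_le_sq'
          (by linarith [neg_abs_le (⟪G x, fderiv ℝ G x (b i)⟫)]) ((le_abs_self _).trans h2)
      _ = ‖G x‖ ^ 2 * ‖fderiv ℝ G x (b i)‖ ^ 2 := by ring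
      _ ≤ q * ‖fderiv ℝ G x (b i)‖ ^ 2 := by gcongr; linarith
  have h3 : ⟪G x, basisLaplacian b G x⟫ ≤ c * q := h.trans (by gcongr; linarith)
  have hp2 : 0 ≤ p - 2 := by linarith
  have hp0 : 0 ≤ p := by linarith
  calc _ ≤ p * q ^ (p / 2 - 1) * (gradSq b G x + c * q)
        + p * (p - 2) * q ^ (p / 2 - 2) * (q * gradSq b G x) := by gcongr
    _ = _ := by rw [hqq, hqq']; ring

end Power

end

/-! ### The energy estimate for `C²` solutions. -/

section

variable {E : Type*} [NormedAddCommGroup E] [InnerProductSpace ℝ E] [FiniteDimensional ℝ E]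
  [MeasurableSpace E] [BorelSpace E] {σ : Measure (sphere (0 : E) 1)} [IsFiniteMeasure σ]
  {ι : Type*} [Fintype ι]
  {F : Type*} [NormedAddCommGroup F] [InnerProductSpace ℝ F]

/-- The integrand bounding the Laplacian of `smoothPow p G`. -/
noncomputable def density (b : OrthonormalBasis ι ℝ E) (p c : ℝ) (G : E → F) (x : E) : ℝ :=
  p * (p - 1) * ((1 + ‖G x‖ ^ 2) ^ (p / 2 - 1) * gradSq b G x) + p * c * smoothPow p G x

/-- The mean of `smoothPow p G` over the sphere of radius `s`. -/
noncomputable def powMean (σ : Measure (sphere (0 : E) 1)) (p : ℝ) (G : E → F) (s : ℝ) : ℝ :=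
  ∫ ζ : sphere (0 : E) 1, smoothPow p G (s • (ζ : E)) ∂σ

/-- The radial derivative of `powMean`. -/
noncomputable def powFlux (σ : Measure (sphere (0 : E) 1)) (p : ℝ) (G : E → F) (s : ℝ) : ℝ :=
  ∫ ζ : sphere (0 : E) 1, p * (1 + ‖G (s • (ζ : E))‖ ^ 2) ^ (p / 2 - 1)
    * ⟪G (s • (ζ : E)), fderiv ℝ G (s • (ζ : E)) (ζ : E)⟫ ∂σ

/-- Monotonicity and Taylor estimate for the means of `smoothPow p G`. -/
def EnergyEstimate (σ : Measure (sphere (0 : E) 1)) (b : OrthonormalBasis ι ℝ E) (p c : ℝ)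
    (G : E → F) (R : ℝ) : Prop :=
  ∀ a r : ℝ, 0 < a → a ≤ r → r < R → powMean σ p G a ≤ powMean σ p G r ∧
    powMean σ p G r ≤ powMean σ p G a + (r - a) * powFlux σ p G a
      + ∫ s in a..r, (r - s) * ∫ ζ : sphere (0 : E) 1, density b p c G (s • (ζ : E)) ∂σ

omit [FiniteDimensional ℝ E] [MeasurableSpace E] [BorelSpace E] in
theorem continuous_density {p c : ℝ} {G : E → F} (hG : ContDiff ℝ 1 G)
    (b : OrthonormalBasis ι ℝ E) : Continuous (density b p c G) := by
  have h0 := hG.continuous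
  have h1 := hG.continuous_fderiv one_ne_zero
  have h2 : Continuous fun x => (1 + ‖G x‖ ^ 2) ^ (p / 2 - 1) :=
    (show Continuous fun x => 1 + ‖G x‖ ^ 2 by fun_prop).rpow_const
      fun x => Or.inl (one_add_norm_sq_pos (G x)).ne'
  have h3 : Continuous (smoothPow p G) := (contDiff_smoothPow (k := 1) p hG).continuous
  unfold density gradSq
  fun_prop

theorem energyEstimate_of_contDiff (hσ : RotationInvariant σ) (b : OrthonormalBasis ι ℝ E)
    (hι : 2 ≤ Fintype.card ι) {p c R : ℝ} (hp : 2 ≤ p) (hc : 0 ≤ c) {T : F → F}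
    (hT : ∀ w, 0 ≤ ⟪w, T w⟫ ∧ ⟪w, T w⟫ ≤ c * ‖w‖ ^ 2) {G : E → F} (hG : ContDiff ℝ 2 G)
    (hpde : ∀ x ∈ ball (0 : E) R, basisLaplacian b G x = T (G x)) :
    EnergyEstimate σ b p c G R := by
  intro a r ha har hr
  have hφ : ContDiff ℝ 2 (smoothPow p G) := contDiff_smoothPow (k := 2) p hG
  have hsub : ∀ x ∈ ball (0 : E) R, 0 ≤ basisLaplacian b (smoothPow p G) x := fun x hx =>
    basisLaplacian_smoothPow_nonneg hp hG b (by rw [hpde x hx]; exact (hT _).1)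
  have hdc := continuous_density (p := p) (c := c) (hG.of_le one_le_two) b
  refine ⟨mean_mono hσ hφ b hι hsub ha har hr, ?_⟩
  have h := mean_le_taylor hσ hφ b hι hsub
    (B := fun s => ∫ ζ : sphere (0 : E) 1, density b p c G (s • (ζ : E)) ∂σ)
    (continuous_integral_compact
      (F := fun s (ζ : sphere (0 : E) 1) => density b p c G (s • (ζ : E)))
      (by unfold Function.uncurry; fun_prop)) ha har hr ?_
  · simpa only [powMean, powFlux, fderiv_smoothPow_apply p (hG.of_le one_le_two)] using h
  · intro s hs
    have hlap : Continuous (basisLaplacian b (smoothPow p G)) := by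
      have := continuous_hessian hφ
      unfold basisLaplacian
      fun_prop
    refine integral_mono (integrable_of_continuous_compact (by fun_prop))
      (integrable_of_continuous_compact (by fun_prop)) fun ζ => ?_
    have hmem : s • (ζ : E) ∈ ball (0 : E) R := by
      rw [mem_ball_zero_iff, norm_smul]
      simpa [abs_of_pos (ha.trans_le hs.1)] using hs.2.trans_lt hr
    exact basisLaplacian_smoothPow_le hp hG b hc (by rw [hpde _ hmem]; exact (hT _).2)

/-! ### The energy estimate for derivatives of solutions, by difference quotients. -/

section Limit

variable [FiniteDimensional ℝ F]

/-- Passage to the limit in spherical integrals depending on a function and its derivative. -/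
theorem tendsto_integral_jet {H : F × (E →L[ℝ] F) × E → ℝ} (hH : Continuous H)
    {G : ℕ → E → F} {g : E → F} (hG : ∀ n, ContDiff ℝ 1 (G n)) {M : ℝ}
    (hM : ∀ n x, ‖G n x‖ ≤ M) (hM' : ∀ n x, ‖fderiv ℝ (G n) x‖ ≤ M)
    (hlim : ∀ x, Tendsto (fun n => G n x) atTop (𝓝 (g x)))
    (hlim' : ∀ x, Tendsto (fun n => fderiv ℝ (G n) x) atTop (𝓝 (fderiv ℝ g x))) :
    (∀ s : ℝ, Tendsto (fun n => ∫ ζ : sphere (0 : E) 1,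
      H (G n (s • (ζ : E)), fderiv ℝ (G n) (s • (ζ : E)), (ζ : E)) ∂σ) atTop
      (𝓝 (∫ ζ : sphere (0 : E) 1, H (g (s • (ζ : E)), fderiv ℝ g (s • (ζ : E)), (ζ : E)) ∂σ))) ∧
    ∃ C : ℝ, ∀ n (s : ℝ), ‖∫ ζ : sphere (0 : E) 1,
      H (G n (s • (ζ : E)), fderiv ℝ (G n) (s • (ζ : E)), (ζ : E)) ∂σ‖ ≤ C := by
  have hK : IsCompact (closedBall (0 : F) M ×ˢ (closedBall (0 : E →L[ℝ] F) M
      ×ˢ closedBall (0 : E) 1)) :=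
    (isCompact_closedBall _ _).prod ((isCompact_closedBall _ _).prod (isCompact_closedBall _ _))
  obtain ⟨C, hC⟩ := hK.exists_bound_of_continuousOn hH.continuousOn
  have hbd : ∀ n (s : ℝ) (ζ : sphere (0 : E) 1),
      ‖H (G n (s • (ζ : E)), fderiv ℝ (G n) (s • (ζ : E)), (ζ : E))‖ ≤ C := fun n s ζ =>
    hC _ ⟨by simpa using hM n _, by simpa using hM' n _, by simp⟩
  refine ⟨fun s => ?_, C * σ.real univ, fun n s => ?_⟩
  · refine tendsto_integral_of_dominated_convergence (fun _ => C) (fun n => ?_)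
      (integrable_const C) (fun n => Eventually.of_forall (hbd n s))
      (Eventually.of_forall fun ζ => ?_)
    · have h0 := (hG n).continuous
      have h1 := (hG n).continuous_fderiv one_ne_zero
      exact (integrable_of_continuous_compact (by fun_prop)).aestronglyMeasurable
    · exact (hH.tendsto _).comp ((hlim _).prodMk_nhds ((hlim' _).prodMk_nhds tendsto_const_nhds))
  · exact norm_integral_le_of_norm_le_const (Eventually.of_forall (hbd n s))

/-- The estimate involves only `G` and its first derivative, so bounded pointwise convergence of
both suffices. Each approximant is only required to satisfy it on smaller balls from some index on,
which allows for the translations in difference quotients. -/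
theorem energyEstimate_of_tendsto (b : OrthonormalBasis ι ℝ E) {p c R : ℝ}
    {G : ℕ → E → F} {g : E → F} (hG : ∀ n, ContDiff ℝ 1 (G n)) {M : ℝ}
    (hM : ∀ n x, ‖G n x‖ ≤ M) (hM' : ∀ n x, ‖fderiv ℝ (G n) x‖ ≤ M)
    (hlim : ∀ x, Tendsto (fun n => G n x) atTop (𝓝 (g x)))
    (hlim' : ∀ x, Tendsto (fun n => fderiv ℝ (G n) x) atTop (𝓝 (fderiv ℝ g x)))
    (h : ∀ R' < R, ∀ᶠ n in atTop, EnergyEstimate σ b p c (G n) R') :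
    EnergyEstimate σ b p c g R := by
  intro a r ha har hr
  obtain ⟨R', hrR', hR'⟩ := exists_between hr
  have hpow : ∀ e : ℝ, Continuous fun z : F × (E →L[ℝ] F) × E => (1 + ‖z.1‖ ^ 2) ^ e := fun e =>
    (show Continuous fun z : F × (E →L[ℝ] F) × E => 1 + ‖z.1‖ ^ 2 by fun_prop).rpow_const
      fun z => Or.inl (one_add_norm_sq_pos z.1).ne'
  have hp0 := hpow (p / 2)
  have hp1 := hpow (p / 2 - 1)
  obtain ⟨t1, -⟩ := tendsto_integral_jet (σ := σ) hp0 hG hM hM' hlim hlim'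
  obtain ⟨t2, -⟩ := tendsto_integral_jet (σ := σ)
    (H := fun z => p * (1 + ‖z.1‖ ^ 2) ^ (p / 2 - 1) * ⟪z.1, z.2.1 z.2.2⟫)
    (by fun_prop) hG hM hM' hlim hlim'
  obtain ⟨t3, C, hC⟩ := tendsto_integral_jet (σ := σ)
    (H := fun z => p * (p - 1) * ((1 + ‖z.1‖ ^ 2) ^ (p / 2 - 1) * ∑ i, ‖z.2.1 (b i)‖ ^ 2)
      + p * c * (1 + ‖z.1‖ ^ 2) ^ (p / 2))
    (by fun_prop) hG hM hM' hlim hlim'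
  have t4 : Tendsto (fun n => ∫ s in a..r, (r - s)
      * ∫ ζ : sphere (0 : E) 1, density b p c (G n) (s • (ζ : E)) ∂σ) atTop
      (𝓝 (∫ s in a..r, (r - s) * ∫ ζ : sphere (0 : E) 1, density b p c g (s • (ζ : E)) ∂σ)) := by
    refine intervalIntegral.tendsto_integral_filter_of_dominated_convergence
      (fun s => |r - s| * C) (Eventually.of_forall fun n => ?_)
      (Eventually.of_forall fun n => Eventually.of_forall fun s _ => ?_)
      (Continuous.intervalIntegrable (by fun_prop) _ _)
      (Eventually.of_forall fun s _ => (t3 s).const_mul (r - s))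
    · have hd := continuous_density (p := p) (c := c) (hG n) b
      have := continuous_integral_compact (μ := σ)
        (F := fun s (ζ : sphere (0 : E) 1) => density b p c (G n) (s • (ζ : E)))
        (by unfold Function.uncurry; fun_prop)
      exact (Continuous.aestronglyMeasurable (by fun_prop))
    · rw [norm_mul, Real.norm_eq_abs]
      exact mul_le_mul_of_nonneg_left (hC n s) (abs_nonneg _)
  have hev := h R' hR'
  constructor
  · refine le_of_tendsto_of_tendsto (t1 a) (t1 r) ?_
    filter_upwards [hev] with n hn
    exact (hn a r ha har hrR').1
  · refine le_of_tendsto_of_tendsto (t1 r) (((t1 a).add ((t2 a).const_mul (r - a))).add t4) ?_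
    filter_upwards [hev] with n hn
    exact (hn a r ha har hrR').2

section DiffQuot

variable {G : Type*} [NormedAddCommGroup G] [NormedSpace ℝ G]

/-- The difference quotient of `f` in the direction `e`. -/
noncomputable def diffQuot (f : E → G) (e : E) (h : ℝ) (x : E) : G := h⁻¹ • (f (x + h • e) - f x)

omit [FiniteDimensional ℝ E] [MeasurableSpace E] [BorelSpace E] in
theorem tendsto_diffQuot {f : E → G} {x : E} (hf : DifferentiableAt ℝ f x) (e : E) :
    Tendsto (fun n : ℕ => diffQuot f e ((n : ℝ) + 1)⁻¹ x) atTop (𝓝 (fderiv ℝ f x e)) := by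
  have h1 := hasDerivAt_comp_line (f := f) (x := x) (v := e) (t := 0) (by simpa using hf)
  rw [hasDerivAt_iff_tendsto_slope_zero] at h1
  simp only [zero_add, zero_smul, add_zero] at h1
  refine h1.comp (tendsto_nhdsWithin_iff.2 ⟨?_, Eventually.of_forall fun n => ?_⟩)
  · simpa using tendsto_one_div_add_atTop_nhds_zero_nat (𝕜 := ℝ)
  · have : ((n : ℝ) + 1)⁻¹ ≠ 0 := by positivity
    exact this

omit [FiniteDimensional ℝ E] [MeasurableSpace E] [BorelSpace E] in
theorem norm_diffQuot_le {f : E → G} (hf : Differentiable ℝ f) {C : ℝ}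
    (hC : ∀ x, ‖fderiv ℝ f x‖ ≤ C) (e : E) (h : ℝ) (x : E) : ‖diffQuot f e h x‖ ≤ C * ‖e‖ := by
  rcases eq_or_ne h 0 with rfl | hh
  · simpa [diffQuot] using mul_nonneg ((norm_nonneg _).trans (hC 0)) (norm_nonneg e)
  have := Convex.norm_image_sub_le_of_norm_fderiv_le (fun y _ => hf y) (fun y _ => hC y)
    convex_univ (mem_univ x) (mem_univ (x + h • e))
  rw [add_sub_cancel_left, norm_smul] at this
  rw [diffQuot, norm_smul, norm_inv, inv_mul_le_iff₀ (norm_pos_iff.2 hh)]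
  linarith

omit [FiniteDimensional ℝ E] [MeasurableSpace E] [BorelSpace E] in
theorem contDiff_diffQuot {f : E → G} {k : ℕ∞} (hf : ContDiff ℝ k f) (e : E) (h : ℝ) :
    ContDiff ℝ k (diffQuot f e h) :=
  contDiff_const.smul ((hf.comp (contDiff_id.add contDiff_const)).sub hf)

omit [FiniteDimensional ℝ E] [MeasurableSpace E] [BorelSpace E] in
theorem fderiv_diffQuot {f : E → G} (hf : Differentiable ℝ f) (e : E) (h : ℝ) :
    fderiv ℝ (diffQuot f e h) = diffQuot (fderiv ℝ f) e h := by
  funext x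
  have h1 : HasFDerivAt (fun x => f (x + h • e)) (fderiv ℝ f (x + h • e)) x := by
    simpa [Function.comp_def] using
      (hf (x + h • e)).hasFDerivAt.comp x ((hasFDerivAt_id x).add_const (h • e))
  exact ((h1.sub (hf x).hasFDerivAt).const_smul h⁻¹).fderiv

omit [FiniteDimensional ℝ E] [MeasurableSpace E] [BorelSpace E] in
theorem exists_bound_fderiv {f : E → G} (hf : ContDiff ℝ 1 f) (hs : HasCompactSupport f) :
    ∃ C, ∀ x, ‖fderiv ℝ f x‖ ≤ C := by
  have hs' : HasCompactSupport (fderiv ℝ f) := hs.fderiv ℝ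
  exact hs'.exists_bound_of_continuous (hf.continuous_fderiv one_ne_zero)

end DiffQuot

omit [FiniteDimensional ℝ F] [FiniteDimensional ℝ E] [MeasurableSpace E] [BorelSpace E] in
theorem basisLaplacian_diffQuot {f : E → F} (hf : ContDiff ℝ 2 f) (b : OrthonormalBasis ι ℝ E)
    (e : E) (h : ℝ) (x : E) :
    basisLaplacian b (diffQuot f e h) x = diffQuot (basisLaplacian b f) e h x := by
  have hf1 : ContDiff ℝ 1 (fderiv ℝ f) := hf.fderiv_right (by norm_num)
  simp only [basisLaplacian, fderiv_diffQuot (hf.differentiable two_ne_zero),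
    fderiv_diffQuot (hf1.differentiable one_ne_zero)]
  simp only [diffQuot, basisLaplacian, _root_.smul_apply, _root_.sub_apply, ← Finset.smul_sum,
    Finset.sum_sub_distrib]

omit [FiniteDimensional ℝ E] [MeasurableSpace E] [BorelSpace E] [FiniteDimensional ℝ F] in
-- Symmetry of the second derivative. It identifies the limit of the difference quotients of `fderiv
-- ℝ f` with the derivative of `∂ₑf`.
theorem fderiv_fderiv_apply_const {f : E → F} {x : E} (hf : ContDiffAt ℝ 2 f x) (e : E) :
    fderiv ℝ (fun y => fderiv ℝ f y e) x = fderiv ℝ (fderiv ℝ f) x e := by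
  have hd : DifferentiableAt ℝ (fderiv ℝ f) x :=
    (hf.fderiv_right (m := 1) (by norm_num)).differentiableAt one_ne_zero
  have hs : IsSymmSndFDerivAt ℝ f x := hf.isSymmSndFDerivAt (by simp)
  rw [fderiv_clm_apply hd (differentiableAt_const e)]
  ext v
  simp [hs v e]

/-- The function `∂ₑf` is only `C¹`, whereas the difference quotients of `f` are `C²` and, `T` being
linear, solve the same equation on slightly smaller balls. -/
theorem energyEstimate_fderiv (hσ : RotationInvariant σ) (b : OrthonormalBasis ι ℝ E)
    (hι : 2 ≤ Fintype.card ι) {p c R : ℝ} (hp : 2 ≤ p) (hc : 0 ≤ c) {T : F →L[ℝ] F}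
    (hT : ∀ w, 0 ≤ ⟪w, T w⟫ ∧ ⟪w, T w⟫ ≤ c * ‖w‖ ^ 2) {f : E → F} (hf : ContDiff ℝ 2 f)
    (hsupp : HasCompactSupport f)
    (hpde : ∀ x ∈ ball (0 : E) R, basisLaplacian b f x = T (f x)) (e : E) :
    EnergyEstimate σ b p c (fun x => fderiv ℝ f x e) R := by
  have hf1 : ContDiff ℝ 1 (fderiv ℝ f) := hf.fderiv_right (by norm_num)
  obtain ⟨C₁, hC₁⟩ := exists_bound_fderiv (hf.of_le one_le_two) hsupp
  obtain ⟨C₂, hC₂⟩ := exists_bound_fderiv hf1 (hsupp.fderiv ℝ)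
  have hdf := hf.differentiable two_ne_zero
  have hddf := hf1.differentiable one_ne_zero
  refine energyEstimate_of_tendsto b (G := fun n : ℕ => diffQuot f e ((n : ℝ) + 1)⁻¹)
    (M := max (C₁ * ‖e‖) (C₂ * ‖e‖))
    (fun n => contDiff_diffQuot (k := 1) (hf.of_le one_le_two) e _)
    (fun n x => (norm_diffQuot_le hdf hC₁ e _ x).trans (le_max_left _ _))
    (fun n x => ?_) (fun x => tendsto_diffQuot (hdf x) e) (fun x => ?_) (fun R' hR' => ?_)
  · rw [fderiv_diffQuot hdf]
    exact (norm_diffQuot_le hddf hC₂ e _ x).trans (le_max_right _ _)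
  · rw [fderiv_fderiv_apply_const hf.contDiffAt]
    simp only [fderiv_diffQuot hdf]
    exact tendsto_diffQuot (hddf x) e
  · have ht : Tendsto (fun n : ℕ => ((n : ℝ) + 1)⁻¹ * ‖e‖) atTop (𝓝 0) := by
      simpa using (tendsto_one_div_add_atTop_nhds_zero_nat (𝕜 := ℝ)).mul_const ‖e‖
    filter_upwards [ht.eventually (gt_mem_nhds (sub_pos.2 hR'))] with n hn
    refine energyEstimate_of_contDiff hσ b hι hp hc hT
      (contDiff_diffQuot (k := 2) hf e _) fun x hx => ?_
    have hx1 : x ∈ ball (0 : E) R := ball_subset_ball hR'.le hx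
    have hx2 : x + ((n : ℝ) + 1)⁻¹ • e ∈ ball (0 : E) R := by
      rw [mem_ball_zero_iff] at hx ⊢
      have h1 := norm_add_le x (((n : ℝ) + 1)⁻¹ • e)
      rw [norm_smul, Real.norm_of_nonneg (by positivity : (0 : ℝ) ≤ ((n : ℝ) + 1)⁻¹)] at h1
      linarith
    rw [basisLaplacian_diffQuot hf]
    simp only [diffQuot, hpde _ hx1, hpde _ hx2, map_smul, map_sub]

end Limit

/-! ### From compactly supported functions to functions on the unit ball. -/

section Cutoff

omit [FiniteDimensional ℝ E] [BorelSpace E] [IsFiniteMeasure σ] in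
theorem energyEstimate_congr {b : OrthonormalBasis ι ℝ E} {p c R : ℝ} {G g : E → F}
    (h : EnergyEstimate σ b p c G R) (hGg : ∀ x ∈ ball (0 : E) R, G =ᶠ[𝓝 x] g) :
    EnergyEstimate σ b p c g R := by
  intro a r ha har hr
  have hmem : ∀ s ∈ Icc a r, ∀ ζ : sphere (0 : E) 1, s • (ζ : E) ∈ ball (0 : E) R := by
    intro s hs ζ
    rw [mem_ball_zero_iff, norm_smul]
    simpa [abs_of_pos (ha.trans_le hs.1)] using hs.2.trans_lt hr
  have h0 : ∀ s ∈ Icc a r, ∀ ζ : sphere (0 : E) 1, G (s • (ζ : E)) = g (s • (ζ : E)) :=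
    fun s hs ζ => (hGg _ (hmem s hs ζ)).eq_of_nhds
  have h1 : ∀ s ∈ Icc a r, ∀ ζ : sphere (0 : E) 1,
      fderiv ℝ G (s • (ζ : E)) = fderiv ℝ g (s • (ζ : E)) :=
    fun s hs ζ => (hGg _ (hmem s hs ζ)).fderiv_eq
  have hma := left_mem_Icc.2 har
  have hmr := right_mem_Icc.2 har
  have key := h a r ha har hr
  have hint : ∫ s in a..r, (r - s) * ∫ ζ : sphere (0 : E) 1, density b p c G (s • (ζ : E)) ∂σ
      = ∫ s in a..r, (r - s) * ∫ ζ : sphere (0 : E) 1, density b p c g (s • (ζ : E)) ∂σ := by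
    refine intervalIntegral.integral_congr fun s hs => ?_
    rw [uIcc_of_le har] at hs
    simp only [density, gradSq, smoothPow, h0 s hs, h1 s hs]
  rw [hint] at key
  simpa only [powMean, powFlux, smoothPow, h0 a hma, h0 r hmr, h1 a hma] using key

omit [MeasurableSpace E] [BorelSpace E] in
theorem exists_cutoff {f : E → F} (hf : ContDiffOn ℝ 2 f (ball 0 1)) {R : ℝ} (hR0 : 0 < R)
    (hR : R < 1) : ∃ g : E → F, ContDiff ℝ 2 g ∧ HasCompactSupport g ∧
      ∀ x ∈ ball (0 : E) R, g =ᶠ[𝓝 x] f := by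
  obtain ⟨R', h1, h2⟩ := exists_between hR
  -- The bump is `1` on the ball of radius `R` and vanishes beyond `R' < 1`, so `χ • f` is `C²`
  -- everywhere whatever values `f` takes outside the unit ball.
  let χ : ContDiffBump (0 : E) := ⟨R, R', hR0, h1⟩
  refine ⟨fun x => χ x • f x, contDiff_iff_contDiffAt.2 fun x => ?_,
    χ.hasCompactSupport.smul_right, fun x hx => ?_⟩
  · by_cases hx : x ∈ ball (0 : E) 1
    · exact χ.contDiffAt.smul (hf.contDiffAt (isOpen_ball.mem_nhds hx))
    · have hx' : x ∈ (closedBall (0 : E) R')ᶜ := fun h => hx (closedBall_subset_ball h2 h)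
      refine (contDiffAt_const (c := (0 : F))).congr_of_eventuallyEq ?_
      filter_upwards [isClosed_closedBall.isOpen_compl.mem_nhds hx'] with y hy
      have : χ y = 0 := χ.zero_of_le_dist (by
        rw [mem_compl_iff, mem_closedBall, not_le] at hy
        exact hy.le)
      simp [this]
  · filter_upwards [isOpen_ball.mem_nhds hx] with y hy
    simp [χ.one_of_mem_closedBall (ball_subset_closedBall hy)]

omit [FiniteDimensional ℝ E] [MeasurableSpace E] [BorelSpace E] in
theorem basisLaplacian_congr {b : OrthonormalBasis ι ℝ E} {f g : E → F} {x : E}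
    (h : g =ᶠ[𝓝 x] f) : basisLaplacian b g x = basisLaplacian b f x := by
  simp only [basisLaplacian, h.fderiv.fderiv_eq]

variable [FiniteDimensional ℝ F]

/-- The energy estimate for a solution of `Δf = T f` on the unit ball and its first derivatives. -/
theorem energyEstimate_unitBall (hσ : RotationInvariant σ) (b : OrthonormalBasis ι ℝ E)
    (hι : 2 ≤ Fintype.card ι) {p c : ℝ} (hp : 2 ≤ p) (hc : 0 ≤ c) {T : F →L[ℝ] F}
    (hT : ∀ w, 0 ≤ ⟪w, T w⟫ ∧ ⟪w, T w⟫ ≤ c * ‖w‖ ^ 2) {f : E → F}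
    (hf : ContDiffOn ℝ 2 f (ball 0 1))
    (hpde : ∀ x ∈ ball (0 : E) 1, basisLaplacian b f x = T (f x)) :
    EnergyEstimate σ b p c f 1 ∧ ∀ e, EnergyEstimate σ b p c (fun x => fderiv ℝ f x e) 1 := by
  have main : ∀ R, 0 < R → R < 1 →
      EnergyEstimate σ b p c f R ∧ ∀ e, EnergyEstimate σ b p c (fun x => fderiv ℝ f x e) R := by
    intro R hR0 hR
    obtain ⟨g, hg, hgs, hgf⟩ := exists_cutoff hf hR0 hR
    have hpdeg : ∀ x ∈ ball (0 : E) R, basisLaplacian b g x = T (g x) := fun x hx => by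
      rw [basisLaplacian_congr (hgf x hx), (hgf x hx).eq_of_nhds]
      exact hpde x (ball_subset_ball hR.le hx)
    refine ⟨energyEstimate_congr (energyEstimate_of_contDiff hσ b hι hp hc hT hg hpdeg) hgf,
      fun e => energyEstimate_congr (energyEstimate_fderiv hσ b hι hp hc hT hg hgs hpdeg e)
        fun x hx => ?_⟩
    filter_upwards [(hgf x hx).fderiv (𝕜 := ℝ)] with y hy
    rw [hy]
  refine ⟨fun a r ha har hr => ?_, fun e a r ha har hr => ?_⟩ <;>
    obtain ⟨R, h1, h2⟩ := exists_between hr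
  · exact (main R (ha.trans_le har |>.trans h1) h2).1 a r ha har h1
  · exact (main R (ha.trans_le har |>.trans h1) h2).2 e a r ha har h1

end Cutoff

end

/-! ### From the energy estimate to growth of the means. -/

section

/-- A crude Young inequality: replace the smaller of `X` and `Y` by the larger. The lost constant
becomes the factor `2` in the Hölder inequality below. -/
theorem rpow_sub_one_mul_le {e X Y : ℝ} (he : 1 ≤ e) (hX : 0 < X) (hY : 0 ≤ Y) :
    X ^ (e - 1) * Y ≤ X ^ e + Y ^ e := by
  have key : ∀ Z : ℝ, 0 < Z → Z ^ (e - 1) * Z = Z ^ e := fun Z hZ => by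
    rw [← Real.rpow_add_one hZ.ne']; ring_nf
  have hXe : 0 ≤ X ^ e := Real.rpow_nonneg hX.le _
  have hYe : 0 ≤ Y ^ e := Real.rpow_nonneg hY _
  rcases le_or_gt Y X with h | h
  · calc X ^ (e - 1) * Y ≤ X ^ (e - 1) * X := by gcongr
      _ = X ^ e := key X hX
      _ ≤ _ := by linarith
  · calc X ^ (e - 1) * Y ≤ Y ^ (e - 1) * Y := by
          gcongr
      _ = Y ^ e := key Y (hX.trans h)
      _ ≤ _ := by linarith

/-- A form of Hölder's inequality with exponents `e / (e - 1)` and `e`, valid for `e ≥ 1`. -/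
theorem integral_rpow_sub_one_mul_le {X : Type*} [MeasurableSpace X] {μ : Measure X} {e M K : ℝ}
    (he : 1 ≤ e) {Q S : X → ℝ} (hQ : ∀ x, 0 < Q x) (hS : ∀ x, 0 ≤ S x)
    (hQi : Integrable (fun x => Q x ^ e) μ) (hSi : Integrable (fun x => S x ^ e) μ)
    (hM : 0 < M) (hK : 0 < K) (hQM : ∫ x, Q x ^ e ∂μ ≤ M ^ e) (hSK : ∫ x, S x ^ e ∂μ ≤ K ^ e) :
    ∫ x, Q x ^ (e - 1) * S x ∂μ ≤ 2 * M ^ (e - 1) * K := by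
  have hMe : 0 < M ^ e := Real.rpow_pos_of_pos hM e
  have hKe : 0 < K ^ e := Real.rpow_pos_of_pos hK e
  have hMe' : 0 < M ^ (e - 1) := Real.rpow_pos_of_pos hM _
  have hpt : ∀ x, Q x ^ (e - 1) * S x
      ≤ M ^ (e - 1) * K * (Q x ^ e / M ^ e + S x ^ e / K ^ e) := by
    intro x
    have h := rpow_sub_one_mul_le he (div_pos (hQ x) hM) (div_nonneg (hS x) hK.le)
    rw [Real.div_rpow (hQ x).le hM.le, Real.div_rpow (hQ x).le hM.le,
      Real.div_rpow (hS x) hK.le] at h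
    calc Q x ^ (e - 1) * S x = M ^ (e - 1) * K * (Q x ^ (e - 1) / M ^ (e - 1) * (S x / K)) := by
          field_simp
      _ ≤ _ := by gcongr
  have hint : Integrable (fun x => M ^ (e - 1) * K * (Q x ^ e / M ^ e + S x ^ e / K ^ e)) μ :=
    ((hQi.div_const _).add (hSi.div_const _)).const_mul _
  calc ∫ x, Q x ^ (e - 1) * S x ∂μ
      ≤ ∫ x, M ^ (e - 1) * K * (Q x ^ e / M ^ e + S x ^ e / K ^ e) ∂μ :=
        integral_mono_of_nonneg (Eventually.of_forall fun x =>
          mul_nonneg (Real.rpow_nonneg (hQ x).le _) (hS x)) hint (Eventually.of_forall hpt)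
    _ = M ^ (e - 1) * K * ((∫ x, Q x ^ e ∂μ) / M ^ e + (∫ x, S x ^ e ∂μ) / K ^ e) := by
        rw [integral_const_mul, integral_add (hQi.div_const _) (hSi.div_const _),
          integral_div, integral_div]
    _ ≤ M ^ (e - 1) * K * (1 + 1) := by
        gcongr
        · exact (div_le_one hMe).2 hQM
        · exact (div_le_one hKe).2 hSK
    _ = _ := by ring

/-- Since `r - s ≤ 1 - s`, one power of `1 - s` cancels and the rest integrates to a logarithm. -/
theorem intervalIntegral_div_one_sub_sq_le {C a r : ℝ} (hC : 0 ≤ C) (ha : 0 ≤ a) (har : a ≤ r)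
    (hr : r < 1) :
    ∫ s in a..r, (r - s) * (C / (1 - s) ^ 2) ≤ C * Real.log (1 / (1 - r)) := by
  have hpos : ∀ s ∈ uIcc a r, 0 < 1 - s := fun s hs => by
    rw [uIcc_of_le har] at hs
    linarith [hs.2]
  have hd : ∀ s ∈ uIcc a r, HasDerivAt (fun s => -Real.log (1 - s)) ((1 - s)⁻¹) s := by
    intro s hs
    refine (((hasDerivAt_id s).const_sub 1).log (hpos s hs).ne').neg.congr_deriv ?_
    simp [neg_div]
  have hci : ContinuousOn (fun s : ℝ => (1 - s)⁻¹) (uIcc a r) :=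
    ContinuousOn.inv₀ (by fun_prop) fun s hs => (hpos s hs).ne'
  have hc2 : ContinuousOn (fun s : ℝ => (r - s) * (C / (1 - s) ^ 2)) (uIcc a r) :=
    ContinuousOn.mul (by fun_prop) (ContinuousOn.div (by fun_prop) (by fun_prop)
      fun s hs => (pow_pos (hpos s hs) 2).ne')
  have h1 := intervalIntegral.integral_eq_sub_of_hasDerivAt hd hci.intervalIntegrable
  have h2 : ∫ s in a..r, (r - s) * (C / (1 - s) ^ 2) ≤ ∫ s in a..r, C * (1 - s)⁻¹ := by
    refine intervalIntegral.integral_mono_on har hc2.intervalIntegrable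
      (hci.const_mul C).intervalIntegrable fun s hs => ?_
    have h3 := hpos s (by rwa [uIcc_of_le har])
    calc (r - s) * (C / (1 - s) ^ 2) ≤ (1 - s) * (C / (1 - s) ^ 2) := by gcongr
      _ = C * (1 - s)⁻¹ := by field_simp
  rw [intervalIntegral.integral_const_mul, h1] at h2
  refine h2.trans (mul_le_mul_of_nonneg_left ?_ hC)
  rw [one_div, Real.log_inv]
  have : Real.log (1 - a) ≤ 0 := Real.log_nonpos (by linarith) (by linarith)
  linarith

/-- From `log t ≤ t` the logarithm is at most `1 / (1 - s)`, which the weight `r - s ≤ 1 - s`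
cancels. -/
theorem intervalIntegral_log_le {A B a r : ℝ} (hA : 0 ≤ A) (hB : 0 ≤ B) (ha : 0 ≤ a)
    (har : a ≤ r) (hr : r < 1) :
    ∫ s in a..r, (r - s) * (A + B * Real.log (1 / (1 - s))) ≤ A + B := by
  have hpos : ∀ s ∈ uIcc a r, 0 < 1 - s := fun s hs => by
    rw [uIcc_of_le har] at hs
    linarith [hs.2]
  have hc : ContinuousOn (fun s : ℝ => (r - s) * (A + B * Real.log (1 / (1 - s)))) (uIcc a r) := by
    refine ContinuousOn.mul (by fun_prop) (ContinuousOn.add (by fun_prop)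
      (ContinuousOn.mul (by fun_prop) (ContinuousOn.log (ContinuousOn.div (by fun_prop)
        (by fun_prop) fun s hs => (hpos s hs).ne') fun s hs => ?_)))
    exact (one_div_pos.2 (hpos s hs)).ne'
  have h2 : ∫ s in a..r, (r - s) * (A + B * Real.log (1 / (1 - s))) ≤ ∫ _ in a..r, (A + B) := by
    refine intervalIntegral.integral_mono_on har hc.intervalIntegrable
      intervalIntegrable_const fun s hs => ?_
    have h3 := hpos s (by rwa [uIcc_of_le har])
    have h4 : Real.log (1 / (1 - s)) ≤ 1 / (1 - s) := Real.log_le_self (one_div_pos.2 h3).le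
    have h5 : 0 ≤ r - s := by linarith [hs.2]
    have h6 : 0 ≤ s := ha.trans hs.1
    calc (r - s) * (A + B * Real.log (1 / (1 - s))) ≤ (r - s) * (A + B * (1 / (1 - s))) := by
          gcongr
      _ ≤ (1 - s) * (A + B * (1 / (1 - s))) := by gcongr
      _ = (1 - s) * A + B := by field_simp
      _ ≤ A + B := by nlinarith
  refine h2.trans ?_
  rw [intervalIntegral.integral_const, smul_eq_mul]
  nlinarith

variable {E : Type*} [NormedAddCommGroup E] [InnerProductSpace ℝ E] [FiniteDimensional ℝ E]
  [MeasurableSpace E] [BorelSpace E] {σ : Measure (sphere (0 : E) 1)}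
  {ι : Type*} [Fintype ι]
  {F : Type*} [NormedAddCommGroup F] [InnerProductSpace ℝ F]

omit [FiniteDimensional ℝ E] [MeasurableSpace E] [BorelSpace E] in
theorem smul_mem_unitBall {s : ℝ} (hs0 : 0 ≤ s) (hs : s < 1) (ζ : sphere (0 : E) 1) :
    s • (ζ : E) ∈ ball (0 : E) 1 := by
  rw [mem_ball_zero_iff, norm_smul]
  simpa [abs_of_nonneg hs0] using hs

theorem integrable_sphere_of_continuousOn [IsFiniteMeasure σ] {H : E → ℝ}
    (hH : ContinuousOn H (ball 0 1)) {s : ℝ} (hs0 : 0 ≤ s) (hs : s < 1) :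
    Integrable (fun ζ : sphere (0 : E) 1 => H (s • (ζ : E))) σ :=
  integrable_of_continuous_compact
    (hH.comp_continuous (by fun_prop) fun ζ => smul_mem_unitBall hs0 hs ζ)

omit [InnerProductSpace ℝ E] [FiniteDimensional ℝ E] [MeasurableSpace E] [BorelSpace E] [InnerProductSpace ℝ F] in
theorem continuousOn_smoothPow (p : ℝ) {G : E → F} (hG : ContinuousOn G (ball 0 1)) :
    ContinuousOn (smoothPow p G) (ball 0 1) :=
  ContinuousOn.rpow_const (by fun_prop) fun x _ => Or.inl (one_add_norm_sq_pos (G x)).ne'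

omit [FiniteDimensional ℝ E] [MeasurableSpace E] [BorelSpace E] in
theorem continuousOn_gradSq (b : OrthonormalBasis ι ℝ E) {G : E → F}
    (hG : ContDiffOn ℝ 1 G (ball 0 1)) : ContinuousOn (gradSq b G) (ball 0 1) := by
  have := hG.continuousOn_fderiv_of_isOpen isOpen_ball le_rfl
  unfold gradSq
  fun_prop

omit [InnerProductSpace ℝ F] in
theorem one_le_powMean [IsProbabilityMeasure σ] {p : ℝ} (hp : 0 ≤ p) {G : E → F}
    (hG : ContinuousOn G (ball 0 1)) {s : ℝ} (hs0 : 0 ≤ s) (hs : s < 1) : 1 ≤ powMean σ p G s := by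
  have h : ∫ _ : sphere (0 : E) 1, (1 : ℝ) ∂σ ≤ powMean σ p G s :=
    integral_mono (integrable_const _)
      (integrable_sphere_of_continuousOn (continuousOn_smoothPow p hG) hs0 hs) fun ζ =>
        Real.one_le_rpow (le_add_of_nonneg_right (sq_nonneg _)) (by positivity)
  simpa using h

/-- The growth estimate that follows from `EnergyEstimate` after absorbing the zeroth order
term. -/
theorem powMean_rpow_le [IsProbabilityMeasure σ] {b : OrthonormalBasis ι ℝ E} {p c : ℝ}
    (hp : 2 ≤ p) (hc : 0 ≤ c) {G : E → F} (hG : ContDiffOn ℝ 1 G (ball 0 1))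
    (hE : EnergyEstimate σ b p c G 1) {a r : ℝ} (ha : 0 < a) (har : a ≤ r) (hr : r < 1)
    (hsmall : p * c * (1 - a) ^ 2 ≤ 1) {κ : ℝ → ℝ} (hκ : ContinuousOn κ (Icc a r))
    (hκ0 : ∀ s ∈ Icc a r, 0 < κ s)
    (hgrad : ∀ s ∈ Icc a r,
      ∫ ζ : sphere (0 : E) 1, gradSq b G (s • (ζ : E)) ^ (p / 2) ∂σ ≤ κ s ^ (p / 2))
    {Λ : ℝ} (hΛ : ∫ s in a..r, (r - s) * κ s ≤ Λ) :
    powMean σ p G r ^ (2 / p)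
      ≤ 2 * (powMean σ p G a + |powFlux σ p G a|) + 4 * (p * (p - 1)) * Λ := by
  have hp0 : 0 < p := by linarith
  have hp1 : 0 < p * (p - 1) := mul_pos hp0 (by linarith)
  have hpc : 0 ≤ p * c := mul_nonneg hp0.le hc
  have he : 1 ≤ p / 2 := by linarith
  have hGc := hG.continuousOn
  have hr0 : 0 < r := ha.trans_le har
  set m := powMean σ p G with hm
  have hmr : 1 ≤ m r := one_le_powMean hp0.le hGc hr0.le hr
  have hma : 1 ≤ m a := one_le_powMean hp0.le hGc ha.le (har.trans_lt hr)
  -- Thus `M ^ (p / 2) = m r`, which by monotonicity dominates `m s` for all `s ≤ r`: one `M` serves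
  -- in Hölder's inequality on every sphere.
  set M := m r ^ (2 / p) with hMdef
  have hM1 : 1 ≤ M := Real.one_le_rpow hmr (by positivity)
  have hM0 : 0 < M := one_pos.trans_le hM1
  have hMe : M ^ (p / 2) = m r := by
    rw [hMdef, ← Real.rpow_mul (by linarith), show 2 / p * (p / 2) = 1 by field_simp, Real.rpow_one]
  have hMe1 : 1 ≤ M ^ (p / 2 - 1) := Real.one_le_rpow hM1 (by linarith)
  have hdens : ∀ s ∈ Icc a r, ∫ ζ : sphere (0 : E) 1, density b p c G (s • (ζ : E)) ∂σ
      ≤ 2 * (p * (p - 1)) * M ^ (p / 2 - 1) * κ s + p * c * m r := by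
    intro s hs
    have hs0 : 0 < s := ha.trans_le hs.1
    have hs1 : s < 1 := hs.2.trans_lt hr
    have hgc := continuousOn_gradSq b hG
    have hsp := continuousOn_smoothPow p hGc
    have hi1 := integrable_sphere_of_continuousOn (σ := σ) hsp hs0.le hs1
    have hi2 := integrable_sphere_of_continuousOn (σ := σ)
      (H := fun x => gradSq b G x ^ (p / 2))
      (hgc.rpow_const fun x _ => Or.inr (by linarith)) hs0.le hs1
    have hi3 := integrable_sphere_of_continuousOn (σ := σ)
      (H := fun x => (1 + ‖G x‖ ^ 2) ^ (p / 2 - 1) * gradSq b G x)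
      ((ContinuousOn.rpow_const (by fun_prop)
        fun x _ => Or.inl (one_add_norm_sq_pos (G x)).ne').mul hgc) hs0.le hs1
    have hms : m s ≤ m r := (hE s r hs0 hs.2 hr).1
    have hH := integral_rpow_sub_one_mul_le he
      (Q := fun ζ : sphere (0 : E) 1 => 1 + ‖G (s • (ζ : E))‖ ^ 2)
      (S := fun ζ : sphere (0 : E) 1 => gradSq b G (s • (ζ : E)))
      (fun ζ => one_add_norm_sq_pos _) (fun ζ => gradSq_nonneg _ _ _) hi1 hi2 hM0 (hκ0 s hs)
      (by rw [hMe]; exact hms) (hgrad s hs)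
    calc ∫ ζ : sphere (0 : E) 1, density b p c G (s • (ζ : E)) ∂σ
        = p * (p - 1) * (∫ ζ : sphere (0 : E) 1, (1 + ‖G (s • (ζ : E))‖ ^ 2) ^ (p / 2 - 1)
            * gradSq b G (s • (ζ : E)) ∂σ) + p * c * m s := by
          unfold density
          rw [integral_add (hi3.const_mul _) (hi1.const_mul _), integral_const_mul,
            integral_const_mul, hm, powMean]
      _ ≤ p * (p - 1) * (2 * M ^ (p / 2 - 1) * κ s) + p * c * m r := by gcongr
      _ = _ := by ring
  have hdens0 : ∀ s : ℝ, 0 ≤ ∫ ζ : sphere (0 : E) 1, density b p c G (s • (ζ : E)) ∂σ := fun s => by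
    refine integral_nonneg fun ζ => ?_
    have h1 := gradSq_nonneg b G (s • (ζ : E))
    have h2 := one_add_norm_sq_pos (G (s • (ζ : E)))
    have h3 : 0 ≤ smoothPow p G (s • (ζ : E)) := Real.rpow_nonneg h2.le _
    simp only [density, Pi.zero_apply]
    positivity
  have hκi : IntervalIntegrable (fun s => (r - s) * κ s) volume a r := by
    refine ContinuousOn.intervalIntegrable ?_
    rw [uIcc_of_le har]
    fun_prop
  have hsub : ∫ s in a..r, (r - s) = (r - a) ^ 2 / 2 := by
    rw [intervalIntegral.integral_sub intervalIntegrable_const intervalIntegral.intervalIntegrable_id,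
      intervalIntegral.integral_const, integral_id, smul_eq_mul]
    ring
  have hint : ∫ s in a..r, (r - s) * ∫ ζ : sphere (0 : E) 1, density b p c G (s • (ζ : E)) ∂σ
      ≤ 2 * (p * (p - 1)) * M ^ (p / 2 - 1) * Λ + m r / 2 := by
    have hbi : IntervalIntegrable (fun s => 2 * (p * (p - 1)) * M ^ (p / 2 - 1) * ((r - s) * κ s)
        + p * c * m r * (r - s)) volume a r :=
      (hκi.const_mul _).add (Continuous.intervalIntegrable (by fun_prop) _ _)
    have h1 : ∫ s in a..r, (r - s) * ∫ ζ : sphere (0 : E) 1, density b p c G (s • (ζ : E)) ∂σ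
        ≤ ∫ s in a..r, (2 * (p * (p - 1)) * M ^ (p / 2 - 1) * ((r - s) * κ s)
          + p * c * m r * (r - s)) := by
      rw [intervalIntegral.integral_of_le har, intervalIntegral.integral_of_le har]
      -- Nonnegativity of the smaller integrand replaces its integrability in `s`.
      refine integral_mono_of_nonneg ?_ hbi.1 ?_
      · filter_upwards [ae_restrict_mem measurableSet_Ioc] with s hs
        exact mul_nonneg (sub_nonneg.2 hs.2) (hdens0 s)
      · filter_upwards [ae_restrict_mem measurableSet_Ioc] with s hs
        refine (mul_le_mul_of_nonneg_left (hdens s (Ioc_subset_Icc_self hs))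
          (sub_nonneg.2 hs.2)).trans_eq ?_
        ring
    refine h1.trans ?_
    rw [intervalIntegral.integral_add (hκi.const_mul _)
      (Continuous.intervalIntegrable (by fun_prop) _ _), intervalIntegral.integral_const_mul,
      intervalIntegral.integral_const_mul, hsub]
    have h2 : p * c * (r - a) ^ 2 ≤ 1 := by
      refine le_trans ?_ hsmall
      gcongr
    have h3 : p * c * m r * ((r - a) ^ 2 / 2) ≤ m r / 2 := by nlinarith
    have h4 := mul_le_mul_of_nonneg_left hΛ
      (by positivity : 0 ≤ 2 * (p * (p - 1)) * M ^ (p / 2 - 1))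
    linarith
  have hmain := (hE a r ha har hr).2
  have hflux : (r - a) * powFlux σ p G a ≤ |powFlux σ p G a| := by
    calc (r - a) * powFlux σ p G a ≤ (r - a) * |powFlux σ p G a| :=
          mul_le_mul_of_nonneg_left (le_abs_self _) (by linarith)
      _ ≤ 1 * |powFlux σ p G a| := by gcongr; linarith
      _ = _ := one_mul _
  -- The zeroth order term contributed at most `m r / 2`; moving it to the left doubles the other
  -- constants.
  have hfin : m r ≤ 2 * (m a + |powFlux σ p G a|)
      + 4 * (p * (p - 1)) * M ^ (p / 2 - 1) * Λ := by
    linarith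
  have hmul : m r = M ^ (p / 2 - 1) * M := by
    rw [← Real.rpow_add_one hM0.ne', ← hMe]; ring_nf
  have hA : 0 ≤ 2 * (m a + |powFlux σ p G a|) := by positivity
  -- As `M ^ (p / 2 - 1) ≥ 1`, this factor can be put on the constant term as well and then
  -- cancelled.
  have : M ^ (p / 2 - 1) * M ≤ M ^ (p / 2 - 1)
      * (2 * (m a + |powFlux σ p G a|) + 4 * (p * (p - 1)) * Λ) := by
    rw [← hmul]
    refine hfin.trans ?_
    have := mul_le_mul_of_nonneg_right hMe1 hA
    linarith
  exact le_of_mul_le_mul_left this (by linarith)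

omit [FiniteDimensional ℝ E] [MeasurableSpace E] [BorelSpace E] in
theorem contDiffOn_fderiv_apply {f : E → F} (hf : ContDiffOn ℝ 2 f (ball 0 1)) (e : E) :
    ContDiffOn ℝ 1 (fun x => fderiv ℝ f x e) (ball 0 1) :=
  (hf.fderiv_of_isOpen isOpen_ball (by norm_num)).clm_apply contDiffOn_const

/-- Power mean inequality over the `card ι` directions: its factor `card ι ^ (p / 2 - 1)` and the
`card ι` equal bounds combine to `card ι ^ (p / 2)`. -/
theorem integral_gradSq_rpow_le [IsFiniteMeasure σ] {b : OrthonormalBasis ι ℝ E} {p : ℝ}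
    (hp : 2 ≤ p) {f : E → F} (hf : ContDiffOn ℝ 2 f (ball 0 1)) {s L : ℝ} (hs0 : 0 ≤ s)
    (hs : s < 1) (hL : 0 ≤ L)
    (h : ∀ i, powMean σ p (fun x => fderiv ℝ f x (b i)) s ≤ L ^ (p / 2)) :
    ∫ ζ : sphere (0 : E) 1, gradSq b f (s • (ζ : E)) ^ (p / 2) ∂σ
      ≤ (Fintype.card ι * L) ^ (p / 2) := by
  have he : 1 ≤ p / 2 := by linarith
  have hint : ∀ i, Integrable (fun ζ : sphere (0 : E) 1 =>
      smoothPow p (fun x => fderiv ℝ f x (b i)) (s • (ζ : E))) σ := fun i =>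
    integrable_sphere_of_continuousOn
      (continuousOn_smoothPow p (contDiffOn_fderiv_apply hf (b i)).continuousOn) hs0 hs
  have hpt : ∀ x, gradSq b f x ^ (p / 2) ≤ (Fintype.card ι : ℝ) ^ (p / 2 - 1)
      * ∑ i, smoothPow p (fun x => fderiv ℝ f x (b i)) x := by
    intro x
    have h1 := Real.rpow_sum_le_const_mul_sum_rpow_of_nonneg (s := Finset.univ)
      (f := fun i => ‖fderiv ℝ f x (b i)‖ ^ 2) he (fun i _ => sq_nonneg _)
    refine h1.trans ?_
    rw [Finset.card_univ]
    gcongr with i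
    exact Real.rpow_le_rpow (sq_nonneg _) (by linarith) (by linarith)
  calc ∫ ζ : sphere (0 : E) 1, gradSq b f (s • (ζ : E)) ^ (p / 2) ∂σ
      ≤ ∫ ζ : sphere (0 : E) 1, (Fintype.card ι : ℝ) ^ (p / 2 - 1)
        * ∑ i, smoothPow p (fun x => fderiv ℝ f x (b i)) (s • (ζ : E)) ∂σ :=
        integral_mono_of_nonneg
          (Eventually.of_forall fun ζ => Real.rpow_nonneg (gradSq_nonneg _ _ _) _)
          ((integrable_finsetSum _ fun i _ => hint i).const_mul _)
          (Eventually.of_forall fun ζ => hpt _)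
    _ = (Fintype.card ι : ℝ) ^ (p / 2 - 1)
        * ∑ i, powMean σ p (fun x => fderiv ℝ f x (b i)) s := by
        rw [integral_const_mul, integral_finsetSum _ fun i _ => hint i]
        rfl
    _ ≤ (Fintype.card ι : ℝ) ^ (p / 2 - 1) * ∑ _i : ι, L ^ (p / 2) := by
        gcongr with i
        exact h i
    _ = (Fintype.card ι * L) ^ (p / 2) := by
        rw [Finset.sum_const, Finset.card_univ, nsmul_eq_mul, ← mul_assoc,
          Real.mul_rpow (Nat.cast_nonneg _) hL]
        rcases Nat.eq_zero_or_pos (Fintype.card ι) with h0 | h0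
        · rw [h0, Nat.cast_zero, Real.zero_rpow (by linarith : p / 2 ≠ 0)]
          simp
        · rw [← Real.rpow_add_one (by positivity)]
          ring_nf

variable [FiniteDimensional ℝ F]

/-- Growth of a solution of `Δf = T f` and of its gradient when the Hessian grows at most like
`1 / (1 - s)` in the mean. -/
theorem growth_of_hessian_bound [IsProbabilityMeasure σ] (hσ : RotationInvariant σ)
    (b : OrthonormalBasis ι ℝ E) (hι : 2 ≤ Fintype.card ι) {p c : ℝ} (hp : 2 ≤ p) (hc : 0 ≤ c)
    {T : F →L[ℝ] F} (hT : ∀ w, 0 ≤ ⟪w, T w⟫ ∧ ⟪w, T w⟫ ≤ c * ‖w‖ ^ 2) {f : E → F}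
    (hf : ContDiffOn ℝ 2 f (ball 0 1))
    (hpde : ∀ x ∈ ball (0 : E) 1, basisLaplacian b f x = T (f x)) {C a₀ : ℝ} (hC : 0 < C)
    (ha₀ : a₀ < 1)
    (hess : ∀ i, ∀ s ∈ Ioo a₀ 1, ∫ ζ : sphere (0 : E) 1,
      gradSq b (fun x => fderiv ℝ f x (b i)) (s • (ζ : E)) ^ (p / 2) ∂σ
        ≤ (C / (1 - s) ^ 2) ^ (p / 2)) :
    ∃ a A B : ℝ, 0 < a ∧ a < 1 ∧ 0 < A ∧ 0 < B ∧
      (∀ s ∈ Ico a 1, ∫ ζ : sphere (0 : E) 1, gradSq b f (s • (ζ : E)) ^ (p / 2) ∂σ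
        ≤ (A + B * Real.log (1 / (1 - s))) ^ (p / 2)) ∧
      ∃ M : ℝ, ∀ s ∈ Ioo (0 : ℝ) 1, powMean σ p f s ≤ M := by
  have hp0 : 0 < p := by linarith
  have hp1 : 0 < p * (p - 1) := mul_pos hp0 (by linarith)
  have hpc : 0 ≤ p * c := mul_nonneg hp0.le hc
  obtain ⟨hEf, hEd⟩ := energyEstimate_unitBall hσ b hι hp hc hT hf hpde
  have hcard : (0 : ℝ) < Fintype.card ι := by exact_mod_cast (by omega : 0 < Fintype.card ι)
  obtain ⟨a, ha0, haa, ha1, hsmall⟩ : ∃ a : ℝ, 0 < a ∧ a₀ < a ∧ a < 1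
      ∧ p * c * (1 - a) ^ 2 ≤ 1 := by
    have h1 : Tendsto (fun a : ℝ => p * c * (1 - a) ^ 2) (𝓝[<] 1) (𝓝 0) := by
      have : Continuous fun a : ℝ => p * c * (1 - a) ^ 2 := by fun_prop
      have h := this.tendsto 1
      simp only [sub_self, ne_eq, OfNat.ofNat_ne_zero, not_false_eq_true, zero_pow, mul_zero] at h
      exact h.mono_left nhdsWithin_le_nhds
    have h2 : ∀ᶠ a : ℝ in 𝓝[<] 1, max 0 a₀ < a :=
      (lt_mem_nhds (max_lt one_pos ha₀)).filter_mono nhdsWithin_le_nhds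
    obtain ⟨a, h3, h4, h5⟩ := ((h1.eventually (gt_mem_nhds one_pos)).and
      (h2.and self_mem_nhdsWithin)).exists
    exact ⟨a, (le_max_left _ _).trans_lt h4, (le_max_right _ _).trans_lt h4, h5, h3.le⟩
  set g : ι → E → F := fun i x => fderiv ℝ f x (b i) with hg
  -- Summing over all directions yields one constant for every `i`; the `1` makes it positive.
  set A₁ : ℝ := 1 + ∑ i, 2 * (powMean σ p (g i) a + |powFlux σ p (g i) a|) with hA₁
  set B₁ : ℝ := 4 * (p * (p - 1)) * C with hB₁
  have hB₁0 : 0 < B₁ := by positivity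
  have hterm : ∀ i, 0 ≤ 2 * (powMean σ p (g i) a + |powFlux σ p (g i) a|) := fun i => by
    have := one_le_powMean (σ := σ) hp0.le (contDiffOn_fderiv_apply hf (b i)).continuousOn ha0.le
      ha1
    positivity
  have hA₁0 : 0 < A₁ := by
    have := Finset.sum_nonneg fun i (_ : i ∈ Finset.univ) => hterm i
    linarith
  have hlog : ∀ s ∈ Ico a 1, 0 ≤ Real.log (1 / (1 - s)) := fun s hs => by
    refine Real.log_nonneg ?_
    rw [le_div_iff₀ (by linarith [hs.2])]
    linarith [hs.1]
  have hLpos : ∀ s ∈ Ico a 1, 0 < A₁ + B₁ * Real.log (1 / (1 - s)) := fun s hs => by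
    have := mul_nonneg hB₁0.le (hlog s hs)
    linarith
  have hgi : ∀ i, ∀ s ∈ Ico a 1, powMean σ p (g i) s
      ≤ (A₁ + B₁ * Real.log (1 / (1 - s))) ^ (p / 2) := by
    intro i s hs
    have hgc := contDiffOn_fderiv_apply hf (b i)
    have h1 := powMean_rpow_le (σ := σ) hp hc hgc (hEd (b i)) ha0 hs.1 hs.2 hsmall
      (κ := fun t => C / (1 - t) ^ 2)
      (ContinuousOn.div (by fun_prop) (by fun_prop) fun t ht => by
        have : 0 < 1 - t := by linarith [ht.2, hs.2]
        positivity)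
      (fun t ht => by
        have : 0 < 1 - t := by linarith [ht.2, hs.2]
        positivity)
      (fun t ht => hess i t ⟨haa.trans_le ht.1, ht.2.trans_lt hs.2⟩)
      (intervalIntegral_div_one_sub_sq_le hC.le ha0.le hs.1 hs.2)
    have h2 : powMean σ p (g i) s ^ (2 / p) ≤ A₁ + B₁ * Real.log (1 / (1 - s)) := by
      have := Finset.single_le_sum (fun j _ => hterm j) (Finset.mem_univ i)
      refine h1.trans ?_
      rw [hA₁, hB₁]
      linarith
    have hm1 : 1 ≤ powMean σ p (g i) s := one_le_powMean hp0.le hgc.continuousOn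
      (ha0.le.trans hs.1) hs.2
    have hm0 : 0 ≤ powMean σ p (g i) s := zero_le_one.trans hm1
    calc powMean σ p (g i) s = (powMean σ p (g i) s ^ (2 / p)) ^ (p / 2) := by
          rw [← Real.rpow_mul hm0, show 2 / p * (p / 2) = 1 by field_simp, Real.rpow_one]
      _ ≤ _ := Real.rpow_le_rpow (Real.rpow_nonneg hm0 _) h2 (by positivity)
  have hgrad : ∀ s ∈ Ico a 1, ∫ ζ : sphere (0 : E) 1, gradSq b f (s • (ζ : E)) ^ (p / 2) ∂σ
      ≤ (Fintype.card ι * A₁ + Fintype.card ι * B₁ * Real.log (1 / (1 - s))) ^ (p / 2) := by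
    intro s hs
    refine (integral_gradSq_rpow_le hp hf (ha0.le.trans hs.1) hs.2 (hLpos s hs).le
      fun i => hgi i s hs).trans_eq ?_
    congr 1
    ring
  refine ⟨a, Fintype.card ι * A₁, Fintype.card ι * B₁, ha0, ha1, by positivity, by positivity,
    hgrad, ?_⟩
  set A := Fintype.card ι * A₁
  set B := Fintype.card ι * B₁
  have hA : 0 < A := by positivity
  have hB : 0 < B := by positivity
  have hf1 : ContDiffOn ℝ 1 f (ball 0 1) := hf.of_le one_le_two
  set K := 2 * (powMean σ p f a + |powFlux σ p f a|) + 4 * (p * (p - 1)) * (A + B)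
  have hbig : ∀ s ∈ Ico a 1, powMean σ p f s ≤ K ^ (p / 2) := by
    intro s hs
    have h1 := powMean_rpow_le (σ := σ) hp hc hf1 hEf ha0 hs.1 hs.2 hsmall
      (κ := fun t => A + B * Real.log (1 / (1 - t)))
      (ContinuousOn.add (by fun_prop) (ContinuousOn.mul (by fun_prop)
        (ContinuousOn.log (ContinuousOn.div (by fun_prop) (by fun_prop) fun t ht => by
          linarith [ht.2, hs.2]) fun t ht => by
          have : 0 < 1 - t := by linarith [ht.2, hs.2]
          positivity)))
      (fun t ht => by
        have := mul_nonneg hB.le (hlog t ⟨ht.1, ht.2.trans_lt hs.2⟩)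
        linarith)
      (fun t ht => hgrad t ⟨ht.1, ht.2.trans_lt hs.2⟩)
      (intervalIntegral_log_le hA.le hB.le ha0.le hs.1 hs.2)
    have hm1 : 1 ≤ powMean σ p f s := one_le_powMean hp0.le hf1.continuousOn
      (ha0.le.trans hs.1) hs.2
    have hm0 : 0 ≤ powMean σ p f s := zero_le_one.trans hm1
    calc powMean σ p f s = (powMean σ p f s ^ (2 / p)) ^ (p / 2) := by
          rw [← Real.rpow_mul hm0, show 2 / p * (p / 2) = 1 by field_simp, Real.rpow_one]
      _ ≤ _ := Real.rpow_le_rpow (Real.rpow_nonneg hm0 _) h1 (by positivity)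
  refine ⟨K ^ (p / 2), fun s hs => ?_⟩
  -- Radii below `a` are covered by monotonicity of the means.
  exact (hEf s (max a s) hs.1 (le_max_right _ _) (max_lt ha1 hs.2)).1.trans
    (hbig _ ⟨le_max_left _ _, max_lt ha1 hs.2⟩)

end

/-! ### Wirtinger derivatives on `ℂⁿ` and the Yukawa equation. -/

theorem norm_sq_wirtinger (a b : ℂ) :
    ‖(1 / 2) * (a - Complex.I * b)‖ ^ 2 + ‖(1 / 2) * (a + Complex.I * b)‖ ^ 2
      = (1 / 2) * (‖a‖ ^ 2 + ‖b‖ ^ 2) := by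
  have h := parallelogram_law_with_norm ℝ a (Complex.I * b)
  rw [norm_mul Complex.I b, Complex.norm_I, one_mul] at h
  rw [norm_mul, norm_mul]
  norm_num
  linarith

/-- The real orthonormal basis of `ℂⁿ` consisting of the vectors `e_k` and `i e_k`. -/
noncomputable def realBasis (n : ℕ) : OrthonormalBasis ((_ : Fin n) × Fin 2) ℝ (Cn n) :=
  Pi.orthonormalBasis fun _ : Fin n => Complex.orthonormalBasisOneI

theorem realBasis_zero {n : ℕ} (k : Fin n) :
    realBasis n ⟨k, 0⟩ = EuclideanSpace.single k (1 : ℂ) := by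
  rw [realBasis, Pi.orthonormalBasis_apply]
  simp [EuclideanSpace.single]

theorem realBasis_one {n : ℕ} (k : Fin n) :
    realBasis n ⟨k, 1⟩ = EuclideanSpace.single k Complex.I := by
  rw [realBasis, Pi.orthonormalBasis_apply]
  simp [EuclideanSpace.single]

theorem sum_realBasis_index {n : ℕ} {M : Type*} [AddCommMonoid M]
    (φ : (_ : Fin n) × Fin 2 → M) : ∑ i, φ i = ∑ k, (φ ⟨k, 0⟩ + φ ⟨k, 1⟩) := by
  simp [Fintype.sum_sigma]

theorem sum_norm_sq_dz_dzbar {n : ℕ} (g : Cn n → ℂ) (z : Cn n) :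
    ∑ k, (‖dz k g z‖ ^ 2 + ‖dzbar k g z‖ ^ 2) = (1 / 2) * gradSq (realBasis n) g z := by
  simp only [dz, dzbar, norm_sq_wirtinger, gradSq, sum_realBasis_index, realBasis_zero,
    realBasis_one, Finset.mul_sum]

theorem norm_sq_D {n : ℕ} (f : Cn n → ℂ) (z : Cn n) :
    ‖D f z‖ ^ 2 = (1 / 2) * gradSq (realBasis n) f z := by
  rw [← sum_norm_sq_dz_dzbar, EuclideanSpace.norm_sq_eq, Fintype.sum_sum_type,
    Finset.sum_add_distrib]
  simp [D]

theorem gradSq_dz_add_gradSq_dzbar {n : ℕ} {f : Cn n → ℂ} {z : Cn n} (hf : ContDiffAt ℝ 2 f z)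
    (k : Fin n) :
    gradSq (realBasis n) (dz k f) z + gradSq (realBasis n) (dzbar k f) z
      = (1 / 2) * (gradSq (realBasis n) (fun x => fderiv ℝ f x (realBasis n ⟨k, 0⟩)) z
        + gradSq (realBasis n) (fun x => fderiv ℝ f x (realBasis n ⟨k, 1⟩)) z) := by
  have hd : DifferentiableAt ℝ (fderiv ℝ f) z :=
    (hf.fderiv_right (m := 1) (by norm_num)).differentiableAt one_ne_zero
  have hu : ∀ e, HasFDerivAt (fun x => fderiv ℝ f x e) (fderiv ℝ (fun x => fderiv ℝ f x e) z) z :=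
    fun e => (hd.clm_apply (differentiableAt_const e)).hasFDerivAt
  have h0 := hu (EuclideanSpace.single k 1)
  have h1 := hu (EuclideanSpace.single k Complex.I)
  have hz : fderiv ℝ (dz k f) z = _ := ((h0.sub (h1.const_mul Complex.I)).const_mul (1 / 2)).fderiv
  have hzb : fderiv ℝ (dzbar k f) z = _ :=
    ((h0.add (h1.const_mul Complex.I)).const_mul (1 / 2)).fderiv
  simp only [gradSq, hz, hzb, realBasis_zero, realBasis_one]
  rw [← Finset.sum_add_distrib, ← Finset.sum_add_distrib, Finset.mul_sum]
  refine Finset.sum_congr rfl fun i _ => ?_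
  rw [← norm_sq_wirtinger]
  simp only [_root_.smul_apply, _root_.sub_apply, _root_.add_apply, smul_eq_mul]

/-- Passing from Wirtinger to real derivatives costs a factor `1 / 2` at each of the two orders. -/
theorem Dstar_sq {n : ℕ} {f : Cn n → ℂ} {z : Cn n} (hf : ContDiffAt ℝ 2 f z) :
    Dstar f z ^ 2
      = (1 / 4) * ∑ i, gradSq (realBasis n) (fun x => fderiv ℝ f x (realBasis n i)) z := by
  rw [Dstar, Real.sq_sqrt (Finset.sum_nonneg fun _ _ => Finset.sum_nonneg fun _ _ => by positivity),
    Finset.sum_comm, sum_realBasis_index, Finset.mul_sum]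
  refine Finset.sum_congr rfl fun k _ => ?_
  have h := gradSq_dz_add_gradSq_dzbar hf k
  have h1 := sum_norm_sq_dz_dzbar (dz k f) z
  have h2 := sum_norm_sq_dz_dzbar (dzbar k f) z
  calc _ = ∑ j, (‖dz j (dz k f) z‖ ^ 2 + ‖dzbar j (dz k f) z‖ ^ 2)
        + ∑ j, (‖dz j (dzbar k f) z‖ ^ 2 + ‖dzbar j (dzbar k f) z‖ ^ 2) := by
        rw [← Finset.sum_add_distrib]
        exact Finset.sum_congr rfl fun j _ => by ring
    _ = _ := by
        rw [h1, h2]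
        linarith

theorem isProbabilityMeasure_sphereMeasure {n : ℕ} (hn : 1 ≤ n) :
    IsProbabilityMeasure (sphereMeasure n) := by
  have : Nonempty (Fin n) := ⟨⟨0, hn⟩⟩
  have : Nontrivial (Cn n) := inferInstance
  refine ⟨?_⟩
  rw [sphereMeasure, Measure.smul_apply, smul_eq_mul]
  refine ENNReal.inv_mul_cancel ?_ (measure_ne_top _ _)
  rw [Ne, Measure.measure_univ_eq_zero]
  exact Measure.toSphere_ne_zero _

theorem rotationInvariant_sphereMeasure (n : ℕ) : RotationInvariant (sphereMeasure n) :=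
  rotationInvariant_toSphere.smul _

/-- The zeroth order operator `w ↦ τ w + η Re w`. -/
noncomputable def yukawaOp (τ η : ℝ) : ℂ →L[ℝ] ℂ :=
  τ • ContinuousLinearMap.id ℝ ℂ + η • Complex.ofRealCLM.comp Complex.reCLM

theorem yukawaOp_apply (τ η : ℝ) (w : ℂ) : yukawaOp τ η w = (τ : ℂ) * w + (η : ℂ) * (w.re : ℂ) := by
  simp [yukawaOp]

/-- The inner product equals `τ |w|² + η (Re w)²`. -/
theorem inner_yukawaOp {τ η : ℝ} (hτ : 0 ≤ τ) (hη : 0 ≤ η) (w : ℂ) :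
    0 ≤ ⟪w, yukawaOp τ η w⟫ ∧ ⟪w, yukawaOp τ η w⟫ ≤ (τ + η) * ‖w‖ ^ 2 := by
  have h : ⟪w, yukawaOp τ η w⟫ = τ * (w.re ^ 2 + w.im ^ 2) + η * w.re ^ 2 := by
    rw [yukawaOp_apply, Complex.inner]
    simp
    ring
  have h2 : ‖w‖ ^ 2 = w.re ^ 2 + w.im ^ 2 := by
    rw [← Complex.normSq_eq_norm_sq, Complex.normSq_apply]; ring
  rw [h, h2]
  constructor
  · positivity
  · have := mul_nonneg hη (sq_nonneg w.im)
    linarith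

theorem basisLaplacian_of_solvesYukawa {n : ℕ} {τ η : ℝ} {f : Cn n → ℂ}
    (h : SolvesYukawa τ η f) : ∀ x ∈ ball (0 : Cn n) 1,
      basisLaplacian (realBasis n) f x = yukawaOp τ η (f x) := by
  intro x hx
  rw [yukawaOp_apply, ← h x hx,
    InnerProductSpace.laplacian_eq_iteratedFDeriv_orthonormalBasis f (realBasis n)]
  simp [basisLaplacian, iteratedFDeriv_two_apply]

/-- By `Dstar_sq` each summand `gradSq` is at most `4 * Dstar ^ 2`, the others being nonnegative. -/
theorem integral_gradSq_le_of_Dstar {n : ℕ} (hn : 1 ≤ n) {p : ℝ} (hp : 2 ≤ p) {f : Cn n → ℂ}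
    (hf : ContDiffOn ℝ 2 f (unitBall n)) {s C : ℝ} (hs0 : 0 ≤ s) (hs : s < 1) (hC : 0 ≤ C)
    (h : integralMean p s (Dstar f) ≤ C) (i : (_ : Fin n) × Fin 2) :
    ∫ ζ : sphere (0 : Cn n) 1,
      gradSq (realBasis n) (fun x => fderiv ℝ f x (realBasis n i)) (s • (ζ : Cn n)) ^ (p / 2)
        ∂(sphereMeasure n) ≤ (4 * C ^ 2) ^ (p / 2) := by
  have := isProbabilityMeasure_sphereMeasure hn
  have hp0 : 0 < p := by linarith
  have hsq : ∀ x ∈ unitBall n, Dstar f x ^ 2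
      = (1 / 4) * ∑ i, gradSq (realBasis n) (fun x => fderiv ℝ f x (realBasis n i)) x :=
    fun x hx => Dstar_sq (hf.contDiffAt (isOpen_ball.mem_nhds hx))
  have hgc : ∀ i, ContinuousOn
      (gradSq (realBasis n) (fun x => fderiv ℝ f x (realBasis n i))) (unitBall n) := fun i =>
    continuousOn_gradSq _ (contDiffOn_fderiv_apply hf _)
  have hDc : ContinuousOn (Dstar f) (unitBall n) := by
    have h1 : ContinuousOn (fun x => Real.sqrt ((1 / 4)
        * ∑ i, gradSq (realBasis n) (fun x => fderiv ℝ f x (realBasis n i)) x)) (unitBall n) := by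
      fun_prop
    refine h1.congr fun x hx => ?_
    simp only [← hsq x hx]
    exact (Real.sqrt_sq (show 0 ≤ Dstar f x from Real.sqrt_nonneg _)).symm
  have hint : Integrable (fun ζ : sphere (0 : Cn n) 1 => ‖Dstar f (s • (ζ : Cn n))‖ ^ p)
      (sphereMeasure n) :=
    integrable_sphere_of_continuousOn (H := fun x => ‖Dstar f x‖ ^ p)
      (hDc.norm.rpow_const fun _ _ => Or.inr hp0.le) hs0 hs
  have hI0 : 0 ≤ ∫ ζ : sphere (0 : Cn n) 1, ‖Dstar f (s • (ζ : Cn n))‖ ^ p ∂(sphereMeasure n) :=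
    integral_nonneg fun ζ => Real.rpow_nonneg (norm_nonneg _) _
  have hI : ∫ ζ : sphere (0 : Cn n) 1, ‖Dstar f (s • (ζ : Cn n))‖ ^ p ∂(sphereMeasure n)
      ≤ C ^ p := by
    have h1 := Real.rpow_le_rpow (Real.rpow_nonneg hI0 _) h hp0.le
    rwa [← Real.rpow_mul hI0, one_div_mul_cancel hp0.ne', Real.rpow_one] at h1
  have hpt : ∀ x ∈ unitBall n,
      gradSq (realBasis n) (fun x => fderiv ℝ f x (realBasis n i)) x ^ (p / 2)
        ≤ 4 ^ (p / 2) * ‖Dstar f x‖ ^ p := by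
    intro x hx
    have h1 : gradSq (realBasis n) (fun x => fderiv ℝ f x (realBasis n i)) x
        ≤ 4 * ‖Dstar f x‖ ^ 2 := by
      have h2 := Finset.single_le_sum
        (f := fun i => gradSq (realBasis n) (fun x => fderiv ℝ f x (realBasis n i)) x)
        (fun j _ => gradSq_nonneg _ _ _) (Finset.mem_univ i)
      rw [Real.norm_eq_abs, sq_abs, hsq x hx]
      linarith
    refine (Real.rpow_le_rpow (gradSq_nonneg _ _ _) h1 (by positivity)).trans_eq ?_
    rw [Real.mul_rpow (by norm_num) (sq_nonneg _), ← Real.rpow_natCast_mul (norm_nonneg _)]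
    congr 2
    push_cast
    ring
  calc _ ≤ ∫ ζ : sphere (0 : Cn n) 1, 4 ^ (p / 2) * ‖Dstar f (s • (ζ : Cn n))‖ ^ p
        ∂(sphereMeasure n) :=
        integral_mono_of_nonneg
          (Eventually.of_forall fun ζ => Real.rpow_nonneg (gradSq_nonneg _ _ _) _)
          (hint.const_mul _) (Eventually.of_forall fun ζ => hpt _ (smul_mem_unitBall hs0 hs ζ))
    _ ≤ 4 ^ (p / 2) * C ^ p := by
        rw [integral_const_mul]
        gcongr
    _ = (4 * C ^ 2) ^ (p / 2) := by
        rw [Real.mul_rpow (by norm_num) (sq_nonneg _), ← Real.rpow_natCast_mul hC]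
        congr 2
        push_cast
        ring

theorem integralMean_D_le {n : ℕ} {p s L : ℝ} (hp : 2 ≤ p) {f : Cn n → ℂ} (hL : 0 ≤ L)
    (hi : Integrable (fun ζ : sphere (0 : Cn n) 1 =>
      gradSq (realBasis n) f (s • (ζ : Cn n)) ^ (p / 2)) (sphereMeasure n))
    (h : ∫ ζ : sphere (0 : Cn n) 1, gradSq (realBasis n) f (s • (ζ : Cn n)) ^ (p / 2)
      ∂(sphereMeasure n) ≤ L ^ (p / 2)) :
    integralMean p s (D f) ≤ L ^ (1 / 2 : ℝ) := by
  have hp0 : 0 < p := by linarith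
  have hpt : ∀ x, ‖D f x‖ ^ p ≤ gradSq (realBasis n) f x ^ (p / 2) := by
    intro x
    have h1 := gradSq_nonneg (realBasis n) f x
    have h2 := norm_sq_D f x
    calc ‖D f x‖ ^ p = (‖D f x‖ ^ 2) ^ (p / 2) := by
          rw [← Real.rpow_natCast_mul (norm_nonneg _)]
          congr 1
          push_cast
          ring
      _ ≤ _ := by
          rw [h2]
          exact Real.rpow_le_rpow (by positivity) (by linarith) (by positivity)
  have h1 : ∫ ζ : sphere (0 : Cn n) 1, ‖D f (s • (ζ : Cn n))‖ ^ p ∂(sphereMeasure n)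
      ≤ L ^ (p / 2) :=
    (integral_mono_of_nonneg (Eventually.of_forall fun ζ => Real.rpow_nonneg (norm_nonneg _) _) hi
      (Eventually.of_forall fun ζ => hpt _)).trans h
  calc integralMean p s (D f) ≤ (L ^ (p / 2)) ^ (1 / p) :=
        Real.rpow_le_rpow (integral_nonneg fun ζ => Real.rpow_nonneg (norm_nonneg _) _) h1
          (by positivity)
    _ = L ^ (1 / 2 : ℝ) := by
        rw [← Real.rpow_mul hL]
        congr 1
        field_simp

theorem integralMean_nonneg {n : ℕ} {G : Type*} [NormedAddCommGroup G] (p r : ℝ) (F : Cn n → G) :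
    0 ≤ integralMean p r F :=
  Real.rpow_nonneg (integral_nonneg fun _ => Real.rpow_nonneg (norm_nonneg _) _) _

theorem memHardy_of_powMean_le {n : ℕ} (hn : 1 ≤ n) {p M : ℝ} (hp : 2 ≤ p) {f : Cn n → ℂ}
    (hf : ContinuousOn f (unitBall n))
    (hM : ∀ s ∈ Ioo (0 : ℝ) 1, powMean (sphereMeasure n) p f s ≤ M) : MemHardy p f := by
  have := isProbabilityMeasure_sphereMeasure hn
  have hp0 : 0 < p := by linarith
  refine ⟨(continuousOn_iff_continuous_domRestrict.1 hf).measurable, fun r hr => ?_, ?_⟩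
  · exact integrable_sphere_of_continuousOn (H := fun x => ‖f x‖ ^ p)
      (hf.norm.rpow_const fun _ _ => Or.inr hp0.le) hr.1.le hr.2
  · refine ⟨M ^ (1 / p), ?_⟩
    rintro _ ⟨r, hr, rfl⟩
    have hpt : ∀ x, ‖f x‖ ^ p ≤ smoothPow p f x := fun x => by
      calc ‖f x‖ ^ p = (‖f x‖ ^ 2) ^ (p / 2) := by
            rw [← Real.rpow_natCast_mul (norm_nonneg _)]
            congr 1
            push_cast
            ring
        _ ≤ _ := Real.rpow_le_rpow (sq_nonneg _) (by linarith) (by positivity)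
    have h1 : ∫ ζ : sphere (0 : Cn n) 1, ‖f (r • (ζ : Cn n))‖ ^ p ∂(sphereMeasure n) ≤ M :=
      (integral_mono_of_nonneg (Eventually.of_forall fun ζ => Real.rpow_nonneg (norm_nonneg _) _)
        (integrable_sphere_of_continuousOn (continuousOn_smoothPow p hf) hr.1.le hr.2)
        (Eventually.of_forall fun ζ => hpt _)).trans (hM r hr)
    exact Real.rpow_le_rpow (integral_nonneg fun ζ => Real.rpow_nonneg (norm_nonneg _) _) h1
      (by positivity)

end SphericalMean

theorem mainTheorem11 (n : ℕ) (hn : 1 ≤ n) (p τ η : ℝ) (hp : 2 ≤ p) (hτ : 0 ≤ τ) (hη : 0 ≤ η)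
    (hsum : η + τ < 4 * (n : ℝ) / p) (f : YukawaHardy.Cn n → ℂ)
    (hf : ContDiffOn ℝ 2 f (YukawaHardy.unitBall n))
    (hpde : YukawaHardy.SolvesYukawa τ η f)
    (hD : (fun r : ℝ => YukawaHardy.integralMean p r (YukawaHardy.Dstar f))
      =O[𝓝[<] (1 : ℝ)] fun r : ℝ => 1 / (1 - r)) :
    ((fun r : ℝ => YukawaHardy.integralMean p r (YukawaHardy.D f))
      =O[𝓝[<] (1 : ℝ)] fun r : ℝ => (Real.log (1 / (1 - r))) ^ (1 / 2 : ℝ))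
    ∧ YukawaHardy.MemHardy p f := by
  open YukawaHardy SphericalMean Set Metric in
  have := isProbabilityMeasure_sphereMeasure hn
  have hp0 : 0 < p := by linarith
  obtain ⟨C, hC, hDC⟩ := hD.exists_pos
  obtain ⟨a₀, ha₀, hbound⟩ := (mem_nhdsLT_iff_exists_Ioo_subset).1 hDC.bound
  have hess : ∀ i, ∀ s ∈ Ioo (max 0 a₀) 1, ∫ ζ : sphere (0 : Cn n) 1,
      gradSq (realBasis n) (fun x => fderiv ℝ f x (realBasis n i)) (s • (ζ : Cn n)) ^ (p / 2)
        ∂(sphereMeasure n) ≤ (4 * C ^ 2 / (1 - s) ^ 2) ^ (p / 2) := by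
    intro i s hs
    have h1s : 0 < 1 - s := by linarith [hs.2]
    have h1 : ‖integralMean p s (Dstar f)‖ ≤ C * ‖1 / (1 - s)‖ :=
      hbound ⟨(le_max_right _ _).trans_lt hs.1, hs.2⟩
    rw [Real.norm_of_nonneg (integralMean_nonneg _ _ _),
      Real.norm_of_nonneg (by positivity)] at h1
    refine (integral_gradSq_le_of_Dstar hn hp hf ((le_max_left _ _).trans hs.1.le) hs.2
      (by positivity) h1 i).trans_eq ?_
    congr 1
    field_simp
  have hcard : 2 ≤ Fintype.card ((_ : Fin n) × Fin 2) := by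
    simp only [Fintype.card_sigma, Fintype.card_fin, Finset.sum_const, Finset.card_univ,
      smul_eq_mul]
    omega
  obtain ⟨a, A, B, ha0, ha1, hA, hB, hgrad, M, hM⟩ := growth_of_hessian_bound
    (rotationInvariant_sphereMeasure n) (realBasis n) hcard hp (add_nonneg hτ hη)
    (inner_yukawaOp hτ hη) hf (basisLaplacian_of_solvesYukawa hpde)
    (by positivity : 0 < 4 * C ^ 2) (max_lt one_pos ha₀) hess
  refine ⟨?_, memHardy_of_powMean_le hn hp hf.continuousOn hM⟩
  have hlog : Tendsto (fun r : ℝ => Real.log (1 / (1 - r))) (𝓝[<] 1) atTop := by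
    refine Real.tendsto_log_atTop.comp ?_
    simp only [one_div]
    refine tendsto_inv_nhdsGT_zero.comp (tendsto_nhdsWithin_iff.2 ⟨?_, ?_⟩)
    · have : Continuous fun r : ℝ => 1 - r := by fun_prop
      simpa using (this.tendsto 1).mono_left nhdsWithin_le_nhds
    · filter_upwards [self_mem_nhdsWithin] with r hr
      exact sub_pos.2 (show r < 1 from hr)
  -- Near `1` the logarithm is at least `1`, so `A + B log ≤ (A + B) log`.
  refine IsBigO.of_bound ((A + B) ^ (1 / 2 : ℝ)) ?_
  filter_upwards [hlog.eventually_ge_atTop 1, Ioo_mem_nhdsLT ha1] with r hr1 hr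
  have hr0 : 0 ≤ r := ha0.le.trans hr.1.le
  have hL : 0 ≤ A + B * Real.log (1 / (1 - r)) := by positivity
  have hi := integrable_sphere_of_continuousOn (σ := sphereMeasure n)
    (H := fun x => gradSq (realBasis n) f x ^ (p / 2))
    ((continuousOn_gradSq (realBasis n) (hf.of_le one_le_two)).rpow_const
      fun _ _ => Or.inr (by positivity)) hr0 hr.2
  rw [Real.norm_of_nonneg (integralMean_nonneg _ _ _),
    Real.norm_of_nonneg (Real.rpow_nonneg (by linarith) _), ← Real.mul_rpow (by positivity)
    (by linarith)]
  refine (integralMean_D_le hp hL hi (hgrad r ⟨hr.1.le, hr.2⟩)).trans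
    (Real.rpow_le_rpow hL ?_ (by norm_num))
  have : A * 1 ≤ A * Real.log (1 / (1 - r)) := by gcongr
  linarith
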